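/- Let $M$ be a smooth manifold (compactness is not needed) with a transversely holomorphic foliation $\mathcal F$ of complex codimension $n$: an open cover $\{U_i\}$ of $M$, a complex $n$-dimensional manifold $T_0$, smooth submersions $f_i\colon U_i\to T_0$ with connected fibres, and holomorphic maps $\gamma_{ij}$ from $f_i(U_i\cap U_j)$ to $T_0$ with $f_j=\gamma_{ij}\circ f_i$ on $U_i\cap U_j$ (so $\gamma_{ij}$ is biholomorphic onto its image, with inverse $\gamma_{ji}$). For $\mathbb K\in\{\mathbb R,\mathbb C\}$ let $\Omega^k(M/\mathcal F,\mathbb K)$ be the space of basic forms, i.e. smooth $\mathbb K$-valued $k$-forms $\omega$ on $M$ with $i_X\omega=i_Xd\omega=0$ for all $X$ tangent to the leaves, and let $$H^k(M/\mathcal F,\mathbb K)=\frac{\ker\big(d\colon\Omega^k(M/\mathcal F,\mathbb K)\to\Omega^{k+1}(M/\mathcal F,\mathbb K)\big)}{d\,\Omega^{k-1}(M/\mathcal F,\mathbb K)}$$ be the basic cohomology. Let $\Omega^{p,q}(M/\mathcal F)\subset\Omega^{p+q}(M/\mathcal F,\mathbb C)$ be the space of basic forms of type $(p,q)$ with respect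 to the transverse complex structure, and write $d=\partial+\bar\partial$ with $\partial\colon\Omega^{p,q}\to\Omega^{p+1,q}$ and $\bar\partial\colon\Omega^{p,q}\to\Omega^{p,q+1}$. The basic Bott–Chern and Aeppli cohomologies are $$H^{p,q}_{BC}(M/\mathcal F)=\frac{\ker\partial\cap\ker\bar\partial\cap\Omega^{p,q}(M/\mathcal F)}{\partial\bar\partial\,\Omega^{p-1,q-1}(M/\mathcal F)},\qquad H^{p,q}_{A}(M/\mathcal F)=\frac{\ker\partial\bar\partial\cap\Omega^{p,q}(M/\mathcal F)}{\partial\,\Omega^{p-1,q}(M/\mathcal F)+\bar\partial\,\Omega^{p,q-1}(M/\mathcal F)}.$$ If $H^k(M/\mathcal F,\mathbb K)$ is infinite dimensional for some $k\ge 0$ and some $\mathbb K\in\{\mathbb R,\mathbb C\}$, then there are $p,q\ge 0$ with $p+q=k$ such that $H^{p,q}_{BC}(M/\mathcal F)$ or $H^{p,q}_{A}(M/\mathcal F)$ is infinite dimensional over $\mathbb C$. -/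

import Mathlib

open scoped Manifold ContDiff ComplexConjugate

noncomputable section

/-! ### Differential forms on a smooth manifold -/

/-- Differential `k`-forms (not necessarily smooth) on the `m`-manifold `M` with values in `𝕜`:
an alternating `ℝ`-multilinear form on every tangent space. -/
def DiffForm (m : ℕ) (M : Type*) [TopologicalSpace M]
    [ChartedSpace (EuclideanSpace ℝ (Fin m)) M] (𝕜 : Type*) [RCLike 𝕜] (k : ℕ) :=
  (x : M) → TangentSpace (𝓡 m) x [⋀^Fin k]→L[ℝ] 𝕜

namespace DiffForm

variable {m : ℕ} {M : Type*} [TopologicalSpace M] [ChartedSpace (EuclideanSpace ℝ (Fin m)) M]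
  {𝕜 : Type*} [RCLike 𝕜] {k : ℕ}

instance : AddCommGroup (DiffForm m M 𝕜 k) :=
  inferInstanceAs (AddCommGroup ((x : M) → TangentSpace (𝓡 m) x [⋀^Fin k]→L[ℝ] 𝕜))

instance : Module 𝕜 (DiffForm m M 𝕜 k) :=
  inferInstanceAs (Module 𝕜 ((x : M) → TangentSpace (𝓡 m) x [⋀^Fin k]→L[ℝ] 𝕜))

@[simp]
theorem zero_apply (x : M) : (0 : DiffForm m M 𝕜 k) x = 0 := rfl

@[simp]
theorem add_apply (α β : DiffForm m M 𝕜 k) (x : M) : (α + β) x = α x + β x := rfl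

@[simp]
theorem smul_apply (c : 𝕜) (α : DiffForm m M 𝕜 k) (x : M) : (c • α) x = c • α x := rfl

/-- The expression of a form in the chart `φ` around `x₀`: the pullback of `α` under `φ⁻¹`. -/
def inChart (α : DiffForm m M 𝕜 k) (x₀ : M) :
    EuclideanSpace ℝ (Fin m) → EuclideanSpace ℝ (Fin m) [⋀^Fin k]→L[ℝ] 𝕜 :=
  fun z ↦ (α ((extChartAt (𝓡 m) x₀).symm z)).compContinuousLinearMap
    (mfderiv (𝓡 m) (𝓡 m) (extChartAt (𝓡 m) x₀).symm z)

/-- A form is smooth if its expression in every chart is smooth. -/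
def IsSmooth (α : DiffForm m M 𝕜 k) : Prop :=
  ∀ x₀ : M, ContDiffOn ℝ ∞ (α.inChart x₀) (extChartAt (𝓡 m) x₀).target

/-- The exterior derivative: at `x`, it is computed in the chart `φ` around `x` and pulled back
by `φ`. -/
def d (α : DiffForm m M 𝕜 k) : DiffForm m M 𝕜 (k + 1) :=
  fun x ↦ (extDeriv (α.inChart x) (extChartAt (𝓡 m) x x)).compContinuousLinearMap
    (mfderiv (𝓡 m) (𝓡 m) (extChartAt (𝓡 m) x) x)

theorem inChart_add (α η : DiffForm m M 𝕜 k) (x₀ : M) :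
    inChart (α + η) x₀ = inChart α x₀ + inChart η x₀ := rfl

theorem inChart_smul (c : 𝕜) (α : DiffForm m M 𝕜 k) (x₀ : M) :
    inChart (c • α) x₀ = c • inChart α x₀ := rfl

theorem inChart_zero (x₀ : M) : inChart (0 : DiffForm m M 𝕜 k) x₀ = 0 := rfl

theorem IsSmooth.differentiableAt {α : DiffForm m M 𝕜 k} (h : IsSmooth α) (x : M) :
    DifferentiableAt ℝ (inChart α x) (extChartAt (𝓡 m) x x) :=
  ((h x).contDiffAt ((isOpen_extChartAt_target (I := 𝓡 m) x).mem_nhds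
    (mem_extChartAt_target (I := 𝓡 m) x))).differentiableAt (by simp)

theorem isSmooth_zero : IsSmooth (0 : DiffForm m M 𝕜 k) := fun x₀ ↦ by
  rw [inChart_zero]; exact contDiffOn_const

theorem IsSmooth.add {α η : DiffForm m M 𝕜 k} (h : IsSmooth α) (h' : IsSmooth η) :
    IsSmooth (α + η) := fun x₀ ↦ by
  rw [inChart_add]; exact (h x₀).add (h' x₀)

theorem IsSmooth.smul {α : DiffForm m M 𝕜 k} (c : 𝕜) (h : IsSmooth α) :
    IsSmooth (c • α) := fun x₀ ↦ by
  rw [inChart_smul]; exact (h x₀).const_smul c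

theorem d_add {α η : DiffForm m M 𝕜 k} (h : IsSmooth α) (h' : IsSmooth η) :
    d (α + η) = d α + d η := by
  funext x
  simp only [d, inChart_add, add_apply, extDeriv_add (h.differentiableAt x)
    (h'.differentiableAt x)]
  rfl

theorem d_smul {α : DiffForm m M 𝕜 k} (c : 𝕜) (h : IsSmooth α) :
    d (c • α) = c • d α := by
  have key (x : M) : extDeriv (c • inChart α x) (extChartAt (𝓡 m) x x) =
      c • extDeriv (inChart α x) (extChartAt (𝓡 m) x x) := by
    ext v
    simp only [extDeriv, fderiv_const_smul (h.differentiableAt x) c,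
      ContinuousAlternatingMap.alternatizeUncurryFin_apply, ContinuousAlternatingMap.smul_apply,
      _root_.smul_apply, Finset.smul_sum]
    exact Finset.sum_congr rfl fun i _ ↦ smul_comm _ _ _
  funext x
  simp only [d, inChart_smul, key, smul_apply]
  rfl

theorem d_zero : d (0 : DiffForm m M 𝕜 k) = 0 := by
  simpa using d_smul (0 : 𝕜) (isSmooth_zero (m := m) (M := M) (𝕜 := 𝕜) (k := k))

end DiffForm

/-! ### Transversely holomorphic foliations -/

/-- A transversely holomorphic foliation of complex codimension `n` on the smooth `m`-manifold `M`,
given by a cocycle with values in the complex `n`-manifold `T₀`: an open cover `U i`, submersions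
`f i` from `U i` to `T₀` with connected fibres, and holomorphic changes of transverse coordinates
`γ i j` with `f j = γ i j ∘ f i` on `U i ∩ U j`. The values of `f i` outside `U i`, and of
`γ i j` outside the open set `f i (U i ∩ U j)`, are irrelevant; on these sets `γ i j` and `γ j i`
are inverse to each other, so that `γ i j` is biholomorphic there. -/
structure TransverselyHolomorphicFoliation (m n : ℕ) (M T₀ ι : Type*)
    [TopologicalSpace M] [ChartedSpace (EuclideanSpace ℝ (Fin m)) M]
    [TopologicalSpace T₀] [ChartedSpace (EuclideanSpace ℂ (Fin n)) T₀] where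
  U : ι → Set M
  isOpen_U : ∀ i, IsOpen (U i)
  cover : ⋃ i, U i = Set.univ
  f : ι → M → T₀
  submersion : ∀ i, ∀ x ∈ U i,
    Manifold.IsSubmersionAt (𝓡 m) 𝓘(ℝ, EuclideanSpace ℂ (Fin n)) ∞ (f i) x
  connected_fibres : ∀ i, ∀ y ∈ f i '' U i, IsConnected (U i ∩ f i ⁻¹' {y})
  γ : ι → ι → T₀ → T₀
  holomorphic : ∀ i j, ∀ y ∈ f i '' (U i ∩ U j),
    MDifferentiableAt 𝓘(ℂ, EuclideanSpace ℂ (Fin n)) 𝓘(ℂ, EuclideanSpace ℂ (Fin n)) (γ i j) y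
  cocycle : ∀ i j, ∀ x ∈ U i ∩ U j, f j x = γ i j (f i x)

namespace TransverselyHolomorphicFoliation

variable {m n : ℕ} {M T₀ ι : Type*}
  [TopologicalSpace M] [ChartedSpace (EuclideanSpace ℝ (Fin m)) M]
  [TopologicalSpace T₀] [ChartedSpace (EuclideanSpace ℂ (Fin n)) T₀]

/-- The differential of `f i` at `x`, with values in the complex vector space `T_{f i x} T₀ = ℂⁿ`. -/
def df (F : TransverselyHolomorphicFoliation m n M T₀ ι) (i : ι) (x : M) :
    TangentSpace (𝓡 m) x →L[ℝ] EuclideanSpace ℂ (Fin n) :=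
  mfderiv (𝓡 m) 𝓘(ℝ, EuclideanSpace ℂ (Fin n)) (F.f i) x

/-- A tangent vector is tangent to the leaves if it is killed by the differentials of the
submersions defining the foliation. -/
def IsTangent (F : TransverselyHolomorphicFoliation m n M T₀ ι) (x : M)
    (v : TangentSpace (𝓡 m) x) : Prop :=
  ∀ i, x ∈ F.U i → F.df i x v = 0

/-- `i_X α = 0` for all `X` tangent to the leaves: `α` vanishes as soon as one of its arguments is
tangent to the leaves. -/
def IsHorizontal (F : TransverselyHolomorphicFoliation m n M T₀ ι) {𝕜 : Type*} [RCLike 𝕜] {k : ℕ}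
    (α : DiffForm m M 𝕜 k) : Prop :=
  ∀ (x : M) (v : Fin k → TangentSpace (𝓡 m) x) (j : Fin k), F.IsTangent x (v j) → α x v = 0

/-- The space `Ω^k(M/F, 𝕜)` of basic forms: smooth forms `α` with `i_X α = i_X dα = 0` for all `X`
tangent to the leaves. -/
def basicForms (F : TransverselyHolomorphicFoliation m n M T₀ ι) (𝕜 : Type*) [RCLike 𝕜] (k : ℕ) :
    Submodule 𝕜 (DiffForm m M 𝕜 k) where
  carrier := {α | α.IsSmooth ∧ F.IsHorizontal α ∧ F.IsHorizontal α.d}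
  zero_mem' := ⟨DiffForm.isSmooth_zero, fun _ _ _ _ ↦ rfl, by
    rw [DiffForm.d_zero]; exact fun _ _ _ _ ↦ rfl⟩
  add_mem' := fun {a b} ha hb ↦ ⟨ha.1.add hb.1, fun x v j h ↦ by
      simp [ha.2.1 x v j h, hb.2.1 x v j h], fun x v j h ↦ by
      simp [DiffForm.d_add ha.1 hb.1, ha.2.2 x v j h, hb.2.2 x v j h]⟩
  smul_mem' := fun c a ha ↦ ⟨ha.1.smul c, fun x v j h ↦ by simp [ha.2.1 x v j h], fun x v j h ↦ by
      simp [DiffForm.d_smul c ha.1, ha.2.2 x v j h]⟩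

/-! ### Basic de Rham cohomology -/

/-- Closed basic forms. -/
def closedForms (F : TransverselyHolomorphicFoliation m n M T₀ ι) (𝕜 : Type*) [RCLike 𝕜] (k : ℕ) :
    Submodule 𝕜 (DiffForm m M 𝕜 k) where
  carrier := {α | α ∈ F.basicForms 𝕜 k ∧ α.d = 0}
  zero_mem' := ⟨zero_mem _, DiffForm.d_zero⟩
  add_mem' := fun ha hb ↦ ⟨add_mem ha.1 hb.1, by
    rw [DiffForm.d_add ha.1.1 hb.1.1, ha.2, hb.2, add_zero]⟩
  smul_mem' := fun c _ ha ↦ ⟨Submodule.smul_mem _ c ha.1, by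
    rw [DiffForm.d_smul c ha.1.1, ha.2, smul_zero]⟩

/-- Exact basic forms: the image of `d` on basic forms. -/
def exactForms (F : TransverselyHolomorphicFoliation m n M T₀ ι) (𝕜 : Type*) [RCLike 𝕜] :
    (k : ℕ) → Submodule 𝕜 (DiffForm m M 𝕜 k)
  | 0 => ⊥
  | k + 1 =>
    { carrier := {η | ∃ α ∈ F.basicForms 𝕜 k, α.d = η}
      zero_mem' := ⟨0, zero_mem _, DiffForm.d_zero⟩
      add_mem' := by
        rintro _ _ ⟨a, ha, rfl⟩ ⟨b, hb, rfl⟩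
        exact ⟨a + b, add_mem ha hb, DiffForm.d_add ha.1 hb.1⟩
      smul_mem' := by
        rintro c _ ⟨a, ha, rfl⟩
        exact ⟨c • a, Submodule.smul_mem _ c ha, DiffForm.d_smul c ha.1⟩ }

/-- The basic cohomology `H^k(M/F)` with coefficients in `𝕜`. -/
abbrev BasicCohomology (F : TransverselyHolomorphicFoliation m n M T₀ ι) (𝕜 : Type*) [RCLike 𝕜]
    (k : ℕ) :=
  F.closedForms 𝕜 k ⧸ (F.exactForms 𝕜 k).submoduleOf (F.closedForms 𝕜 k)

/-! ### The bigrading and the operators `∂` and `∂̄` -/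

/-- The space `Ω^{p,q}(M/F)` of basic `k`-forms of type `(p,q)`. A basic form `α` is, at each point
`x` of `U i`, the pullback under `df i` of an alternating form `β` on the complex vector space
`T_{f i x} T₀`; it is of type `(p,q)` if `β` is, that is, if
`β (c u₁, …, c u_k) = c ^ p * (conj c) ^ q * β (u₁, …, u_k)` for all complex numbers `c`.
This space is zero unless `p + q = k`. -/
def typeForms (F : TransverselyHolomorphicFoliation m n M T₀ ι) (k p q : ℕ) :
    Submodule ℂ (DiffForm m M ℂ k) where
  carrier := {α | α ∈ F.basicForms ℂ k ∧
    ∀ (i : ι), ∀ x ∈ F.U i, ∀ (c : ℂ) (v w : Fin k → TangentSpace (𝓡 m) x),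
      (∀ j, F.df i x (w j) = c • F.df i x (v j)) → α x w = c ^ p * conj c ^ q * α x v}
  zero_mem' := ⟨zero_mem _, fun _ _ _ _ _ _ _ ↦ by simp⟩
  add_mem' := fun ha hb ↦ ⟨add_mem ha.1 hb.1, fun i x hx c v w h ↦ by
    simp [ha.2 i x hx c v w h, hb.2 i x hx c v w h, mul_add]⟩
  smul_mem' := fun c _ ha ↦ ⟨Submodule.smul_mem _ c ha.1, fun i x hx c v w h ↦ by
    simp [ha.2 i x hx c v w h, mul_left_comm]⟩

/-- The graph of `∂ : Ω^{p,q} → Ω^{p+1,q}`: `η = ∂α` is the component of type `(p+1,q)` of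
`dα = ∂α + ∂̄α`, the other component having type `(p,q+1)`. -/
def delGraph (F : TransverselyHolomorphicFoliation m n M T₀ ι) (k p q : ℕ) :
    Submodule ℂ (DiffForm m M ℂ k × DiffForm m M ℂ (k + 1)) where
  carrier := {a | a.1 ∈ F.typeForms k p q ∧ a.2 ∈ F.typeForms (k + 1) (p + 1) q ∧
    a.1.d - a.2 ∈ F.typeForms (k + 1) p (q + 1)}
  zero_mem' := ⟨zero_mem _, zero_mem _, by simp [DiffForm.d_zero, zero_mem]⟩
  add_mem' := fun {a b} ha hb ↦ ⟨add_mem ha.1 hb.1, add_mem ha.2.1 hb.2.1, by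
    have := add_mem ha.2.2 hb.2.2
    rwa [sub_add_sub_comm, ← DiffForm.d_add ha.1.1.1 hb.1.1.1] at this⟩
  smul_mem' := fun c a ha ↦ ⟨Submodule.smul_mem _ c ha.1, Submodule.smul_mem _ c ha.2.1, by
    have := Submodule.smul_mem _ c ha.2.2
    rwa [smul_sub, ← DiffForm.d_smul c ha.1.1.1] at this⟩

/-- The graph of `∂̄ : Ω^{p,q} → Ω^{p,q+1}`: `ζ = ∂̄α` is the component of type `(p,q+1)` of
`dα = ∂α + ∂̄α`, the other component having type `(p+1,q)`. -/
def delbarGraph (F : TransverselyHolomorphicFoliation m n M T₀ ι) (k p q : ℕ) :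
    Submodule ℂ (DiffForm m M ℂ k × DiffForm m M ℂ (k + 1)) where
  carrier := {a | a.1 ∈ F.typeForms k p q ∧ a.2 ∈ F.typeForms (k + 1) p (q + 1) ∧
    a.1.d - a.2 ∈ F.typeForms (k + 1) (p + 1) q}
  zero_mem' := ⟨zero_mem _, zero_mem _, by simp [DiffForm.d_zero, zero_mem]⟩
  add_mem' := fun {a b} ha hb ↦ ⟨add_mem ha.1 hb.1, add_mem ha.2.1 hb.2.1, by
    have := add_mem ha.2.2 hb.2.2
    rwa [sub_add_sub_comm, ← DiffForm.d_add ha.1.1.1 hb.1.1.1] at this⟩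
  smul_mem' := fun c a ha ↦ ⟨Submodule.smul_mem _ c ha.1, Submodule.smul_mem _ c ha.2.1, by
    have := Submodule.smul_mem _ c ha.2.2
    rwa [smul_sub, ← DiffForm.d_smul c ha.1.1.1] at this⟩

/-- The graph of `∂∂̄ : Ω^{p,q} → Ω^{p+1,q+1}`. -/
def delDelbarGraph (F : TransverselyHolomorphicFoliation m n M T₀ ι) (k p q : ℕ) :
    Submodule ℂ (DiffForm m M ℂ k × DiffForm m M ℂ (k + 2)) where
  carrier := {a | ∃ ζ, (a.1, ζ) ∈ F.delbarGraph k p q ∧ (ζ, a.2) ∈ F.delGraph (k + 1) p (q + 1)}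
  zero_mem' := ⟨0, zero_mem (F.delbarGraph k p q), zero_mem (F.delGraph (k + 1) p (q + 1))⟩
  add_mem' := by
    rintro a b ⟨ζ, h₁, h₂⟩ ⟨ζ', h₁', h₂'⟩
    exact ⟨ζ + ζ', add_mem h₁ h₁', add_mem h₂ h₂'⟩
  smul_mem' := by
    rintro c a ⟨ζ, h₁, h₂⟩
    exact ⟨c • ζ, Submodule.smul_mem _ c h₁, Submodule.smul_mem _ c h₂⟩

/-- The kernel of a linear operator given by its graph. -/
def graphKer {V W : Type*} [AddCommGroup V] [Module ℂ V] [AddCommGroup W] [Module ℂ W]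
    (G : Submodule ℂ (V × W)) : Submodule ℂ V :=
  G.comap (LinearMap.inl ℂ V W)

/-- The image of a linear operator given by its graph. -/
def graphIm {V W : Type*} [AddCommGroup V] [Module ℂ V] [AddCommGroup W] [Module ℂ W]
    (G : Submodule ℂ (V × W)) : Submodule ℂ W :=
  G.map (LinearMap.snd ℂ V W)

/-- `im ∂ ∩ Ω^{p,q}`, the image of `∂ : Ω^{p-1,q} → Ω^{p,q}`. -/
def imDel (F : TransverselyHolomorphicFoliation m n M T₀ ι) :
    (k p q : ℕ) → Submodule ℂ (DiffForm m M ℂ k)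
  | k + 1, p + 1, q => graphIm (F.delGraph k p q)
  | _, _, _ => ⊥

/-- `im ∂̄ ∩ Ω^{p,q}`, the image of `∂̄ : Ω^{p,q-1} → Ω^{p,q}`. -/
def imDelbar (F : TransverselyHolomorphicFoliation m n M T₀ ι) :
    (k p q : ℕ) → Submodule ℂ (DiffForm m M ℂ k)
  | k + 1, p, q + 1 => graphIm (F.delbarGraph k p q)
  | _, _, _ => ⊥

/-- `im ∂∂̄ ∩ Ω^{p,q}`, the image of `∂∂̄ : Ω^{p-1,q-1} → Ω^{p,q}`. -/
def imDelDelbar (F : TransverselyHolomorphicFoliation m n M T₀ ι) :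
    (k p q : ℕ) → Submodule ℂ (DiffForm m M ℂ k)
  | k + 2, p + 1, q + 1 => graphIm (F.delDelbarGraph k p q)
  | _, _, _ => ⊥

/-! ### Basic Bott–Chern and Aeppli cohomology -/

/-- `ker ∂ ∩ ker ∂̄ ∩ Ω^{p,q}`. -/
def bottChernCocycles (F : TransverselyHolomorphicFoliation m n M T₀ ι) (k p q : ℕ) :
    Submodule ℂ (DiffForm m M ℂ k) :=
  graphKer (F.delGraph k p q) ⊓ graphKer (F.delbarGraph k p q)

/-- `ker ∂∂̄ ∩ Ω^{p,q}`. -/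
def aeppliCocycles (F : TransverselyHolomorphicFoliation m n M T₀ ι) (k p q : ℕ) :
    Submodule ℂ (DiffForm m M ℂ k) :=
  graphKer (F.delDelbarGraph k p q)

/-- The basic Bott–Chern cohomology
`H^{p,q}_{BC}(M/F) = (ker ∂ ∩ ker ∂̄ ∩ Ω^{p,q}) / (im ∂∂̄ ∩ Ω^{p,q})`. -/
abbrev BottChernCohomology (F : TransverselyHolomorphicFoliation m n M T₀ ι) (p q : ℕ) :=
  F.bottChernCocycles (p + q) p q ⧸
    (F.imDelDelbar (p + q) p q).submoduleOf (F.bottChernCocycles (p + q) p q)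

/-- The basic Aeppli cohomology
`H^{p,q}_A(M/F) = (ker ∂∂̄ ∩ Ω^{p,q}) / ((im ∂ + im ∂̄) ∩ Ω^{p,q})`. -/
abbrev AeppliCohomology (F : TransverselyHolomorphicFoliation m n M T₀ ι) (p q : ℕ) :=
  F.aeppliCocycles (p + q) p q ⧸
    (F.imDel (p + q) p q ⊔ F.imDelbar (p + q) p q).submoduleOf (F.aeppliCocycles (p + q) p q)

end TransverselyHolomorphicFoliation

end

/-! The components of a closed complex form are `∂∂̄`-closed, because closedness turns `∂̄α_{p,q}`
into `-∂α_{p-1,q+1}`, so that `∂∂̄α_{p,q}` has two different types. If the Aeppli cohomology is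
finite-dimensional, closed forms are therefore, up to a finite-dimensional space, sums of
`∂`-exact and `∂̄`-exact forms. Since `∂β = dβ - ∂̄β`, such a closed form is, up to an exact form, a
sum of `∂̄`-exact forms; the components of this sum are `∂̄`-closed, hence also `∂`-closed, that is,
they are Bott–Chern cocycles, and Bott–Chern coboundaries `∂∂̄β = d∂̄β` are exact.

For the type decomposition, the complex numbers act on horizontal forms by rescaling the transverse
directions. Under this action a form of degree `k` is a homogeneous polynomial in `c` and `conj c`,
whose coefficients are its components. In charts in which the leaves are the fibres of
`ℂⁿ × C → ℂⁿ` this action is constant, so that taking components preserves smoothness, and the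
components of `dα` are read off the derivatives of `α`. -/

noncomputable section

open Finset.HasAntidiagonal (antidiagonal mem_antidiagonal)

/-! ### Subspaces modulo finite-dimensional subspaces -/

section FiniteModulo

variable {K X : Type*} [Field K] [AddCommGroup X] [Module K X]

theorem finiteDimensional_quotient_submoduleOf_iff {Z W : Submodule K X} :
    FiniteDimensional K (Z ⧸ W.submoduleOf Z) ↔ ∃ S : Submodule K X, S.FG ∧ Z ≤ W ⊔ S := by
  have hmap : FiniteDimensional K (Z ⧸ W.submoduleOf Z) ↔ (Z.map W.mkQ).FG := by
    have hker : LinearMap.ker (W.mkQ ∘ₗ Z.subtype) = W.submoduleOf Z := by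
      rw [LinearMap.ker_comp, W.ker_mkQ, Submodule.submoduleOf]
    rw [← hker]
    exact Submodule.range_fg_iff_ker_cofg.symm.trans
      (by rw [LinearMap.range_comp, Z.range_subtype])
  rw [hmap]
  constructor
  · intro h
    obtain ⟨σ, hσ⟩ := W.mkQ.exists_rightInverse_of_surjective W.range_mkQ
    refine ⟨(Z.map W.mkQ).map σ, h.map σ, fun z hz ↦ ?_⟩
    have hzW : z - σ (W.mkQ z) ∈ W := by
      rw [← Submodule.Quotient.mk_eq_zero, ← W.mkQ_apply, map_sub, ← LinearMap.comp_apply W.mkQ σ,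
        hσ, LinearMap.id_apply, sub_self]
    rw [← sub_add_cancel z (σ (W.mkQ z))]
    exact Submodule.add_mem_sup hzW ⟨_, ⟨z, hz, rfl⟩, rfl⟩
  · rintro ⟨S, hS, hZ⟩
    refine (hS.map W.mkQ).of_le ((Submodule.map_mono hZ).trans ?_)
    simp [Submodule.map_sup]

theorem exists_fg_le_inf_sup {Z W S : Submodule K X} (hS : S.FG) (hZ : Z ≤ W ⊔ S) :
    ∃ T : Submodule K X, T.FG ∧ Z ≤ (Z ⊓ W) ⊔ T := by
  have hinf : (Z ⊓ W).submoduleOf Z = W.submoduleOf Z := by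
    simp [Submodule.submoduleOf]
  rw [← finiteDimensional_quotient_submoduleOf_iff, hinf]
  exact finiteDimensional_quotient_submoduleOf_iff.2 ⟨S, hS, hZ⟩

theorem exists_fg_iSup_le_iSup_sup {ι : Type*} [Finite ι] {Z W : ι → Submodule K X}
    (h : ∀ i, FiniteDimensional K (Z i ⧸ (W i).submoduleOf (Z i))) :
    ∃ S : Submodule K X, S.FG ∧ ⨆ i, Z i ≤ (⨆ i, W i) ⊔ S := by
  choose S hS hZ using fun i ↦ finiteDimensional_quotient_submoduleOf_iff.1 (h i)
  refine ⟨⨆ i, S i, Submodule.fg_iSup S hS, ?_⟩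
  rw [← iSup_sup_eq]
  exact iSup_mono hZ

theorem finiteDimensional_quotient_of_le_iSup {ι : Type*} [Finite ι] {Z B : Submodule K X}
    {A A' C C' : ι → Submodule K X}
    (hA : ∀ i, FiniteDimensional K (A i ⧸ (A' i).submoduleOf (A i)))
    (hC : ∀ i, FiniteDimensional K (C i ⧸ (C' i).submoduleOf (C i)))
    (hZ : Z ≤ ⨆ i, A i) (hZA' : Z ⊓ ⨆ i, A' i ≤ B ⊔ ⨆ i, C i) (hC' : ∀ i, C' i ≤ B) :
    FiniteDimensional K (Z ⧸ B.submoduleOf Z) := by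
  obtain ⟨S, hS, hAS⟩ := exists_fg_iSup_le_iSup_sup hA
  obtain ⟨T, hT, hZT⟩ := exists_fg_le_inf_sup hS (hZ.trans hAS)
  obtain ⟨R, hR, hCR⟩ := exists_fg_iSup_le_iSup_sup hC
  have hCB : ⨆ i, C i ≤ B ⊔ R := hCR.trans (sup_le_sup_right (iSup_le hC') R)
  refine finiteDimensional_quotient_submoduleOf_iff.2 ⟨R ⊔ T, hR.sup hT, ?_⟩
  calc Z ≤ (Z ⊓ ⨆ i, A' i) ⊔ T := hZT
    _ ≤ (B ⊔ (B ⊔ R)) ⊔ T := sup_le_sup_right (hZA'.trans (sup_le_sup_left hCB B)) T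
    _ = B ⊔ (R ⊔ T) := by rw [← sup_assoc B B, sup_idem, sup_assoc]

theorem finite_quotient_submoduleOf_of_mapsTo {R A B X Y : Type*} [CommRing R]
    [Field A] [Field B] [Algebra R A] [Algebra R B] [Module.Finite R A]
    [AddCommGroup X] [Module R X] [Module A X] [IsScalarTower R A X]
    [AddCommGroup Y] [Module R Y] [Module B Y] [IsScalarTower R B Y]
    {Z W : Submodule A X} {Z' W' : Submodule B Y} (f : X →ₗ[R] Y)
    (hZ : ∀ z' ∈ Z', ∃ z ∈ Z, f z = z') (hW : ∀ w ∈ W, f w ∈ W')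
    (h : FiniteDimensional A (Z ⧸ W.submoduleOf Z)) :
    FiniteDimensional B (Z' ⧸ W'.submoduleOf Z') := by
  obtain ⟨S, ⟨t, rfl⟩, hS⟩ := finiteDimensional_quotient_submoduleOf_iff.1 h
  have ht : ((Submodule.span A (t : Set X)).restrictScalars R).FG := by
    have : Module.Finite R (Submodule.span A (t : Set X)) := Module.Finite.trans A _
    exact Module.Finite.iff_fg.1 this
  obtain ⟨u, hu⟩ := ht.map f
  refine finiteDimensional_quotient_submoduleOf_iff.2 ⟨.span B u, ⟨u, rfl⟩, fun z' hz' ↦ ?_⟩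
  obtain ⟨z, hz, rfl⟩ := hZ z' hz'
  obtain ⟨w, hw, s, hs, rfl⟩ := Submodule.mem_sup.1 (hS hz)
  rw [map_add]
  refine Submodule.add_mem_sup (hW w hw) (Submodule.span_le_restrictScalars R B _ ?_)
  rw [hu]
  exact ⟨s, hs, rfl⟩

end FiniteModulo

/-! ### Bidegree of alternating forms -/

/-- The space of functions `ℂ → ℂ` that are homogeneous polynomials of degree `k` in `c` and
`conj c`. -/
def bihomogeneous (k : ℕ) : Submodule ℂ (ℂ → ℂ) :=
  Submodule.span ℂ {f | ∃ p q, p + q = k ∧ f = fun c ↦ c ^ p * conj c ^ q}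

instance : SetLike.GradedMonoid bihomogeneous where
  one_mem := Submodule.subset_span ⟨0, 0, rfl, by ext; simp⟩
  mul_mem k l f g hf hg := by
    have hfg := Submodule.mul_mem_mul hf hg
    rw [bihomogeneous, bihomogeneous, Submodule.span_mul_span] at hfg
    refine Submodule.span_mono ?_ hfg
    rintro _ ⟨_, ⟨p, q, hpq, rfl⟩, _, ⟨r, s, hrs, rfl⟩, rfl⟩
    refine ⟨p + r, q + s, by omega, funext fun c ↦ ?_⟩
    simp only [Pi.mul_apply]
    ring

theorem re_mem_bihomogeneous : (fun c : ℂ ↦ (c.re : ℂ)) ∈ bihomogeneous 1 := by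
  have hid : (fun c : ℂ ↦ c) ∈ bihomogeneous 1 := Submodule.subset_span ⟨1, 0, by simp⟩
  have hconj : (fun c : ℂ ↦ conj c) ∈ bihomogeneous 1 := Submodule.subset_span ⟨0, 1, by simp⟩
  convert Submodule.smul_mem _ (1 / 2) (add_mem hid hconj) using 2 with c
  simp [Complex.re_eq_add_conj, div_eq_inv_mul]

theorem im_mem_bihomogeneous : (fun c : ℂ ↦ (c.im : ℂ)) ∈ bihomogeneous 1 := by
  have hid : (fun c : ℂ ↦ c) ∈ bihomogeneous 1 := Submodule.subset_span ⟨1, 0, by simp⟩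
  have hconj : (fun c : ℂ ↦ conj c) ∈ bihomogeneous 1 := Submodule.subset_span ⟨0, 1, by simp⟩
  convert Submodule.smul_mem _ (1 / (2 * Complex.I)) (sub_mem hid hconj) using 2 with c
  simp [Complex.im_eq_sub_conj, div_eq_inv_mul]

theorem re_pow_mul_im_pow_mem_bihomogeneous {a b k : ℕ} (hab : a + b = k) :
    (fun c : ℂ ↦ (c.re : ℂ) ^ a * (c.im : ℂ) ^ b) ∈ bihomogeneous k := by
  have h := SetLike.mul_mem_graded (SetLike.pow_mem_graded a re_mem_bihomogeneous)
    (SetLike.pow_mem_graded b im_mem_bihomogeneous)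
  rwa [smul_eq_mul, smul_eq_mul, mul_one, mul_one, hab] at h

/-- The points `exp (π i j / (k + 1))` of the unit circle, whose squares are the roots of unity of
order `k + 1`. -/
def halfRoot (k j : ℕ) : ℂ := Complex.exp (Real.pi * Complex.I / (k + 1 : ℕ)) ^ j

theorem conj_halfRoot (k j : ℕ) : conj (halfRoot k j) = (halfRoot k j)⁻¹ := by
  rw [halfRoot, ← inv_pow, ← Complex.exp_neg, map_pow, ← Complex.exp_conj]
  simp [neg_div]

theorem halfRoot_ne_zero (k j : ℕ) : halfRoot k j ≠ 0 := pow_ne_zero _ (Complex.exp_ne_zero _)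

theorem sum_halfRoot_zpow (k : ℕ) {a : ℤ} (ha : |a| ≤ k) :
    ∑ j ∈ Finset.range (k + 1), halfRoot k j ^ (2 * a) = if a = 0 then (k + 1 : ℂ) else 0 := by
  set ζ := Complex.exp (2 * Real.pi * Complex.I / (k + 1 : ℕ)) with hζ
  have hprim : IsPrimitiveRoot ζ (k + 1) := Complex.isPrimitiveRoot_exp _ k.succ_ne_zero
  have hterm (j : ℕ) : halfRoot k j ^ (2 * a) = (ζ ^ a) ^ j := by
    have hsq : halfRoot k 1 ^ 2 = ζ := by
      rw [halfRoot, pow_one, ← Complex.exp_nat_mul, hζ]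
      congr 1
      push_cast
      ring
    rw [← hsq, halfRoot, halfRoot, pow_one]
    simp only [← zpow_natCast, ← zpow_mul]
    congr 1
    push_cast
    ring
  simp only [hterm]
  split_ifs with h
  · simp [h]
  · have hne : ζ ^ a ≠ 1 := fun h1 ↦ h <| Int.eq_zero_of_abs_lt_dvd
      ((hprim.zpow_eq_one_iff_dvd a).1 h1) (by push_cast; omega)
    have hpow : (ζ ^ a) ^ (k + 1) = 1 := by
      rw [← zpow_natCast, zpow_comm, zpow_natCast, hprim.pow_eq_one, one_zpow]
    rw [geom_sum_eq hne, hpow, sub_self, zero_div]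

/-- The coefficient of `c ^ p * conj c ^ q` in a homogeneous polynomial of degree `k = p + q` in `c`
and `conj c`, computed by averaging over points of the unit circle. -/
def bidegreeCoeff (k p q : ℕ) : (ℂ → ℂ) →ₗ[ℂ] ℂ :=
  (k + 1 : ℂ)⁻¹ • ∑ j ∈ Finset.range (k + 1),
    (conj (halfRoot k j) ^ p * halfRoot k j ^ q) • LinearMap.proj (halfRoot k j)

theorem bidegreeCoeff_monomial {k p q r s : ℕ} (hpq : p + q = k) (hrs : r + s = k) :
    bidegreeCoeff k p q (fun c ↦ c ^ r * conj c ^ s) = if p = r then 1 else 0 := by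
  have hterm (j : ℕ) : conj (halfRoot k j) ^ p * halfRoot k j ^ q *
      (halfRoot k j ^ r * conj (halfRoot k j) ^ s) = halfRoot k j ^ (2 * (r - p : ℤ)) := by
    have hexp : 2 * (r - p : ℤ) = -p + q + (r + -s) := by omega
    have h0 := halfRoot_ne_zero k j
    rw [hexp, zpow_add₀ h0, zpow_add₀ h0, zpow_add₀ h0]
    simp only [conj_halfRoot, zpow_neg, zpow_natCast, inv_pow]
  have hsum : bidegreeCoeff k p q (fun c ↦ c ^ r * conj c ^ s) =
      (k + 1 : ℂ)⁻¹ * ∑ j ∈ Finset.range (k + 1), halfRoot k j ^ (2 * (r - p : ℤ)) := by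
    simp [bidegreeCoeff, hterm]
  have hk : (k + 1 : ℂ) ≠ 0 := Nat.cast_add_one_ne_zero k
  rw [hsum, sum_halfRoot_zpow k (by rw [abs_le]; omega)]
  by_cases h : p = r
  · simp [h, hk]
  · simp [h, sub_eq_zero, Ne.symm h]

theorem apply_eq_sum_bidegreeCoeff {k : ℕ} {f : ℂ → ℂ} (hf : f ∈ bihomogeneous k) (c : ℂ) :
    f c = ∑ x ∈ antidiagonal k, bidegreeCoeff k x.1 x.2 f * (c ^ x.1 * conj c ^ x.2) := by
  induction hf using Submodule.span_induction with
  | mem f hf =>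
    obtain ⟨r, s, hrs, rfl⟩ := hf
    rw [Finset.sum_eq_single_of_mem (r, s) (mem_antidiagonal.2 hrs)]
    · simp [bidegreeCoeff_monomial hrs hrs]
    · rintro ⟨p, q⟩ hpq hne
      rw [mem_antidiagonal] at hpq
      have hpr : p ≠ r := fun h ↦ hne (Prod.ext h (by dsimp only at hpq ⊢; omega))
      rw [bidegreeCoeff_monomial hpq hrs, if_neg hpr, zero_mul]
  | zero => simp
  | add f g _ _ hf hg => simp [hf, hg, add_mul, Finset.sum_add_distrib]
  | smul a f _ hf => simp [hf, Finset.mul_sum, mul_assoc]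

section Horizontal

variable {V E 𝕜 : Type*} [AddCommGroup V] [Module ℝ V] [TopologicalSpace V] [AddCommGroup E]
  [Module ℝ E] [RCLike 𝕜] {k : ℕ}

/-- An alternating form is horizontal along `N` if it vanishes as soon as one of its arguments is in
the kernel of `N`; if `N` is onto, this means that it is a pullback under `N`. -/
def HorizontalAlong (N : V →ₗ[ℝ] E) (β : V [⋀^Fin k]→L[ℝ] 𝕜) : Prop :=
  ∀ (v : Fin k → V) (j : Fin k), N (v j) = 0 → β v = 0

theorem HorizontalAlong.congr {N : V →ₗ[ℝ] E} {β : V [⋀^Fin k]→L[ℝ] 𝕜}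
    (hβ : HorizontalAlong N β) {v w : Fin k → V} (h : ∀ j, N (v j) = N (w j)) : β v = β w := by
  have hexpand := β.toMultilinearMap.map_add_univ w (v - w)
  rw [add_sub_cancel] at hexpand
  refine hexpand.trans ((Finset.sum_eq_single_of_mem Finset.univ (Finset.mem_univ _) ?_).trans ?_)
  · intro S _ hS
    obtain ⟨j, hj⟩ : ∃ j, j ∉ S := not_forall.1 fun hall ↦ hS (Finset.eq_univ_of_forall hall)
    exact hβ _ j (by simp [Finset.piecewise_eq_of_notMem _ _ _ hj, h])
  · simp

end Horizontal

section TypeComponent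

variable {V : Type*} [AddCommGroup V] [Module ℝ V] [TopologicalSpace V] {k : ℕ}

theorem alternating_apply_mem_bihomogeneous (β : V [⋀^Fin k]→L[ℝ] ℂ) (v w : Fin k → V) :
    (fun c : ℂ ↦ β (fun l ↦ c.re • v l + c.im • w l)) ∈ bihomogeneous k := by
  have hterm (c : ℂ) (S : Finset (Fin k)) :
      β (S.piecewise (fun l ↦ c.re • v l) (fun l ↦ c.im • w l)) =
        β (S.piecewise v w) * ((c.re : ℂ) ^ S.card * (c.im : ℂ) ^ Sᶜ.card) := by
    have hsmul : S.piecewise (fun l ↦ c.re • v l) (fun l ↦ c.im • w l) =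
        fun l ↦ S.piecewise (fun _ ↦ c.re) (fun _ ↦ c.im) l • S.piecewise v w l := by
      funext l
      by_cases hl : l ∈ S <;> simp [hl]
    rw [hsmul]
    refine (β.toMultilinearMap.map_smul_univ _ _).trans ?_
    rw [Finset.prod_piecewise, Complex.real_smul, mul_comm]
    simp [Finset.compl_eq_univ_sdiff]
  have hexpand : (fun c : ℂ ↦ β (fun l ↦ c.re • v l + c.im • w l)) = ∑ S : Finset (Fin k),
      β (S.piecewise v w) • fun c : ℂ ↦ (c.re : ℂ) ^ S.card * (c.im : ℂ) ^ Sᶜ.card := by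
    funext c
    refine (β.toMultilinearMap.map_add_univ (fun l ↦ c.re • v l) (fun l ↦ c.im • w l)).trans ?_
    rw [Finset.sum_apply]
    exact Finset.sum_congr rfl fun S _ ↦ hterm c S
  rw [hexpand]
  refine Submodule.sum_mem _ fun S _ ↦ Submodule.smul_mem _ _ ?_
  exact re_pow_mul_im_pow_mem_bihomogeneous (S.card_add_card_compl.trans (Fintype.card_fin k))

variable {E : Type*} [AddCommGroup E] [Module ℂ E] {N : V →ₗ[ℝ] E}

/-- An alternating form has bidegree `(p, q)` along `N` if it is the pullback under `N` of a form
of type `(p, q)`, expressed as in `TransverselyHolomorphicFoliation.typeForms`. -/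
def HasBidegree (N : V →ₗ[ℝ] E) (p q : ℕ) (β : V [⋀^Fin k]→L[ℝ] ℂ) : Prop :=
  ∀ (c : ℂ) (v w : Fin k → V), (∀ j, N (w j) = c • N (v j)) → β w = c ^ p * conj c ^ q * β v

theorem map_re_smul_add_im_smul {J : V →L[ℝ] V} (hJ : ∀ v, N (J v) = Complex.I • N v) (c : ℂ)
    (v : V) : N (c.re • v + c.im • J v) = c • N v := by
  simp only [map_add, map_smul, hJ, ← Complex.coe_smul, smul_smul, ← add_smul, Complex.re_add_im]

variable [IsTopologicalAddGroup V] [ContinuousSMul ℝ V]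

/-- The component of bidegree `(p, q)` of an alternating form of degree `k = p + q`, with respect to
an operator `J` that plays the role of the multiplication by `I`. -/
def typeComponent (J : V →L[ℝ] V) (p q : ℕ) :
    (V [⋀^Fin k]→L[ℝ] ℂ) →L[ℝ] (V [⋀^Fin k]→L[ℝ] ℂ) :=
  (k + 1 : ℂ)⁻¹ • ∑ j ∈ Finset.range (k + 1), (conj (halfRoot k j) ^ p * halfRoot k j ^ q) •
    ContinuousAlternatingMap.compContinuousLinearMapCLM
      ((halfRoot k j).re • ContinuousLinearMap.id ℝ V + (halfRoot k j).im • J)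

theorem typeComponent_apply (J : V →L[ℝ] V) (p q : ℕ) (β : V [⋀^Fin k]→L[ℝ] ℂ) (v : Fin k → V) :
    typeComponent J p q β v =
      bidegreeCoeff k p q (fun c ↦ β (fun l ↦ c.re • v l + c.im • J (v l))) := by
  simp only [typeComponent, bidegreeCoeff, _root_.smul_apply,
    ContinuousAlternatingMap.smul_apply, LinearMap.smul_apply, _root_.sum_apply,
    ContinuousAlternatingMap.sum_apply, LinearMap.sum_apply]
  rfl

theorem apply_eq_sum_typeComponent (J : V →L[ℝ] V) (β : V [⋀^Fin k]→L[ℝ] ℂ) (v : Fin k → V)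
    (c : ℂ) : β (fun l ↦ c.re • v l + c.im • J (v l)) =
      ∑ x ∈ antidiagonal k, typeComponent J x.1 x.2 β v * (c ^ x.1 * conj c ^ x.2) := by
  simp only [typeComponent_apply]
  exact apply_eq_sum_bidegreeCoeff (alternating_apply_mem_bihomogeneous β v fun l ↦ J (v l)) c

theorem sum_typeComponent (J : V →L[ℝ] V) (β : V [⋀^Fin k]→L[ℝ] ℂ) :
    ∑ x ∈ antidiagonal k, typeComponent J x.1 x.2 β = β := by
  ext v
  simpa [ContinuousAlternatingMap.sum_apply] using (apply_eq_sum_typeComponent J β v 1).symm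

variable {J : V →L[ℝ] V} {β : V [⋀^Fin k]→L[ℝ] ℂ} {p q r s : ℕ}

theorem HasBidegree.typeComponent_eq (hβ : HasBidegree N r s β)
    (hJ : ∀ v, N (J v) = Complex.I • N v) (hrs : r + s = k) (hpq : p + q = k) :
    typeComponent J p q β = if p = r then β else 0 := by
  ext v
  have hmono : (fun c : ℂ ↦ β (fun l ↦ c.re • v l + c.im • J (v l))) =
      β v • fun c ↦ c ^ r * conj c ^ s := by
    funext c
    rw [hβ c v _ fun l ↦ map_re_smul_add_im_smul hJ c (v l), Pi.smul_apply, smul_eq_mul, mul_comm]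
  rw [typeComponent_apply, hmono, map_smul, bidegreeCoeff_monomial hpq hrs]
  split_ifs <;> simp

theorem horizontalAlong_typeComponent (hβ : HorizontalAlong N β)
    (hJ : ∀ v, N (J v) = Complex.I • N v) (p q : ℕ) :
    HorizontalAlong N (typeComponent J p q β) := fun v j hv ↦ by
  have hzero : (fun c : ℂ ↦ β (fun l ↦ c.re • v l + c.im • J (v l))) = 0 := by
    funext c
    exact hβ _ j (by rw [map_re_smul_add_im_smul hJ, hv, smul_zero])
  rw [typeComponent_apply, hzero, map_zero]

theorem hasBidegree_typeComponent (hβ : HorizontalAlong N β)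
    (hJ : ∀ v, N (J v) = Complex.I • N v) (hpq : p + q = k) :
    HasBidegree N p q (typeComponent J p q β) := fun c v w h ↦ by
  have hexpand : (fun e : ℂ ↦ β (fun l ↦ e.re • w l + e.im • J (w l))) =
      ∑ x ∈ antidiagonal k, (c ^ x.1 * conj c ^ x.2 * typeComponent J x.1 x.2 β v) •
        fun e ↦ e ^ x.1 * conj e ^ x.2 := by
    funext e
    have hw : β (fun l ↦ e.re • w l + e.im • J (w l)) =
        β (fun l ↦ (e * c).re • v l + (e * c).im • J (v l)) := hβ.congr fun l ↦ by
      rw [map_re_smul_add_im_smul hJ, map_re_smul_add_im_smul hJ, h, smul_smul]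
    rw [hw, apply_eq_sum_typeComponent, Finset.sum_apply]
    refine Finset.sum_congr rfl fun x _ ↦ ?_
    rw [map_mul, mul_pow, mul_pow, Pi.smul_apply, smul_eq_mul]
    ring
  rw [typeComponent_apply, hexpand, map_sum,
    Finset.sum_eq_single_of_mem (p, q) (mem_antidiagonal.2 hpq)]
  · rw [map_smul, bidegreeCoeff_monomial hpq hpq, if_pos rfl, smul_eq_mul, mul_one]
  · rintro ⟨r, s⟩ hrs hne
    rw [mem_antidiagonal] at hrs
    have hpr : p ≠ r := fun h ↦ hne (Prod.ext h.symm (by dsimp only at hrs ⊢; omega))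
    rw [map_smul, bidegreeCoeff_monomial hpq hrs, if_neg hpr, smul_zero]

theorem typeComponent_compContinuousLinearMap {W : Type*} [AddCommGroup W] [Module ℝ W]
    [TopologicalSpace W] [IsTopologicalAddGroup W] [ContinuousSMul ℝ W]
    (hβ : HorizontalAlong N β) (hJ : ∀ v, N (J v) = Complex.I • N v) {σ : W →L[ℝ] V}
    {J' : W →L[ℝ] W} (hJ' : ∀ w, N (σ (J' w)) = Complex.I • N (σ w)) (p q : ℕ) :
    (typeComponent J p q β).compContinuousLinearMap σ =
      typeComponent J' p q (β.compContinuousLinearMap σ) := by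
  ext w
  rw [ContinuousAlternatingMap.compContinuousLinearMap_apply, typeComponent_apply,
    typeComponent_apply]
  congr 1
  funext c
  refine hβ.congr fun l ↦ ?_
  have hlift := map_re_smul_add_im_smul (N := N ∘ₗ σ.toLinearMap) hJ' c (w l)
  rw [map_re_smul_add_im_smul hJ]
  exact hlift.symm

end TypeComponent

section ExteriorDerivative

variable {E W 𝕜 : Type*} [NormedAddCommGroup W] [NormedSpace ℝ W] [RCLike 𝕜] {k : ℕ} {z : W}

theorem fderiv_apply_eq_of_eventuallyEq {A B : W → W [⋀^Fin k]→L[ℝ] 𝕜}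
    (hA : DifferentiableAt ℝ A z) (hB : DifferentiableAt ℝ B z) {v w : Fin k → W}
    (h : ∀ᶠ y in nhds z, A y v = B y w) (u : W) : fderiv ℝ A z u v = fderiv ℝ B z u w := by
  rw [← fderiv_continuousAlternatingMap_apply_const_apply hA,
    ← fderiv_continuousAlternatingMap_apply_const_apply hB]
  exact congrArg (fun L : W →L[ℝ] 𝕜 ↦ L u) (Filter.EventuallyEq.fderiv_eq h)

section Horizontal

variable [AddCommGroup E] [Module ℝ E] {N : W →ₗ[ℝ] E} {A : W → W [⋀^Fin k]→L[ℝ] 𝕜}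

theorem extDeriv_apply_of_horizontalAlong (hA : DifferentiableAt ℝ A z)
    (h : ∀ᶠ y in nhds z, HorizontalAlong N (A y)) {v : Fin (k + 1) → W} {j : Fin (k + 1)}
    (hj : N (v j) = 0) :
    extDeriv A z v = (-1) ^ (j : ℕ) • fderiv ℝ A z (v j) (j.removeNth v) := by
  rw [extDeriv, ContinuousAlternatingMap.alternatizeUncurryFin_apply]
  refine Finset.sum_eq_single_of_mem j (Finset.mem_univ _) fun l _ hl ↦ ?_
  obtain ⟨r, hr⟩ := Fin.exists_succAbove_eq hl.symm
  have hA_zero : ∀ᶠ y in nhds z, A y (l.removeNth v) =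
      (0 : W → W [⋀^Fin k]→L[ℝ] 𝕜) y (l.removeNth v) := by
    filter_upwards [h] with y hy
    exact hy _ r (by simpa [Fin.removeNth, hr] using hj)
  rw [fderiv_apply_eq_of_eventuallyEq hA (differentiableAt_const 0) hA_zero]
  simp

theorem horizontalAlong_extDeriv_iff (hA : DifferentiableAt ℝ A z)
    (h : ∀ᶠ y in nhds z, HorizontalAlong N (A y)) :
    HorizontalAlong N (extDeriv A z) ↔ ∀ u, N u = 0 → fderiv ℝ A z u = 0 := by
  refine ⟨fun hd u hu ↦ ?_, fun hd v j hj ↦ ?_⟩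
  · ext v
    have hcons : N ((Fin.cons u v : Fin (k + 1) → W) 0) = 0 := hu
    simpa [extDeriv_apply_of_horizontalAlong hA h hcons] using hd _ 0 hcons
  · rw [extDeriv_apply_of_horizontalAlong hA h hj, hd _ hj]
    simp

end Horizontal

section Bidegree

variable [AddCommGroup E] [Module ℂ E] {N : W →ₗ[ℝ] E} {A : W → W [⋀^Fin k]→L[ℝ] ℂ}
  {J : W →L[ℝ] W} {p q : ℕ}

theorem horizontalAlong_extDeriv_typeComponent (hA : DifferentiableAt ℝ A z)
    (h : ∀ᶠ y in nhds z, HorizontalAlong N (A y)) (hJ : ∀ v, N (J v) = Complex.I • N v)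
    (hd : HorizontalAlong N (extDeriv A z)) (p q : ℕ) :
    HorizontalAlong N (extDeriv (fun y ↦ typeComponent J p q (A y)) z) := by
  have hderiv := (typeComponent J p q).hasFDerivAt.comp z hA.hasFDerivAt
  have hhor : ∀ᶠ y in nhds z, HorizontalAlong N (typeComponent J p q (A y)) :=
    h.mono fun y hy ↦ horizontalAlong_typeComponent hy hJ p q
  refine (horizontalAlong_extDeriv_iff hderiv.differentiableAt hhor).2 fun u hu ↦ ?_
  refine (congrArg (· u) hderiv.fderiv).trans ?_
  simp [(horizontalAlong_extDeriv_iff hA h).1 hd u hu]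

theorem hasBidegree_fderiv (hA : DifferentiableAt ℝ A z)
    (h : ∀ᶠ y in nhds z, HasBidegree N p q (A y)) (u : W) :
    HasBidegree N p q (fderiv ℝ A z u) := fun c v w hvw ↦ by
  have hscale : ∀ᶠ y in nhds z, A y w = ((c ^ p * conj c ^ q) • A) y v :=
    h.mono fun y hy ↦ hy c v w hvw
  rw [fderiv_apply_eq_of_eventuallyEq hA (hA.const_smul _) hscale, fderiv_const_smul hA]
  rfl

theorem exists_extDeriv_apply_eq_of_hasBidegree (hA : DifferentiableAt ℝ A z)
    (h : ∀ᶠ y in nhds z, HasBidegree N p q (A y)) (hJ : ∀ v, N (J v) = Complex.I • N v)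
    (v : Fin (k + 1) → W) :
    ∃ a b : ℂ, ∀ c : ℂ, extDeriv A z (fun l ↦ c.re • v l + c.im • J (v l)) =
      a * (c ^ (p + 1) * conj c ^ q) + b * (c ^ p * conj c ^ (q + 1)) := by
  let D (u : Fin (k + 1) → W) : ℂ :=
    ∑ l : Fin (k + 1), (-1) ^ (l : ℕ) • fderiv ℝ A z (u l) (l.removeNth v)
  refine ⟨(D v - Complex.I * D (J ∘ v)) / 2, (D v + Complex.I * D (J ∘ v)) / 2, fun c ↦ ?_⟩
  have hscale (l : Fin (k + 1)) (u : W) :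
      fderiv ℝ A z u (l.removeNth fun l ↦ c.re • v l + c.im • J (v l)) =
        c ^ p * conj c ^ q * fderiv ℝ A z u (l.removeNth v) :=
    hasBidegree_fderiv hA h u c _ _ fun _ ↦ map_re_smul_add_im_smul hJ c _
  have hsum : extDeriv A z (fun l ↦ c.re • v l + c.im • J (v l)) =
      c ^ p * conj c ^ q * (c.re * D v + c.im * D (J ∘ v)) := by
    simp only [extDeriv, ContinuousAlternatingMap.alternatizeUncurryFin_apply, D, hscale,
      Finset.mul_sum, ← Finset.sum_add_distrib]
    refine Finset.sum_congr rfl fun l _ ↦ ?_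
    simp only [map_add, map_smul, ContinuousAlternatingMap.add_apply,
      ContinuousAlternatingMap.smul_apply, Complex.real_smul, zsmul_eq_mul, Function.comp_apply]
    ring
  have hI : (2 * Complex.I)⁻¹ = -Complex.I / 2 := by
    rw [mul_inv, Complex.inv_I]
    ring
  rw [hsum, Complex.re_eq_add_conj, Complex.im_eq_sub_conj, div_eq_mul_inv (c - conj c), hI]
  ring

theorem typeComponent_extDeriv_eq_zero (hA : DifferentiableAt ℝ A z)
    (h : ∀ᶠ y in nhds z, HasBidegree N p q (A y)) (hJ : ∀ v, N (J v) = Complex.I • N v)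
    (hpq : p + q = k) {r s : ℕ} (hrs : r + s = k + 1) (hrp : r ≠ p) (hrp' : r ≠ p + 1) :
    typeComponent J r s (extDeriv A z) = 0 := by
  ext v
  obtain ⟨a, b, hab⟩ := exists_extDeriv_apply_eq_of_hasBidegree hA h hJ v
  have hmonomials : (fun c : ℂ ↦ extDeriv A z (fun l ↦ c.re • v l + c.im • J (v l))) =
      a • (fun c ↦ c ^ (p + 1) * conj c ^ q) + b • fun c ↦ c ^ p * conj c ^ (q + 1) :=
    funext hab
  rw [typeComponent_apply, hmonomials, map_add, map_smul, map_smul,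
    bidegreeCoeff_monomial hrs (by omega), bidegreeCoeff_monomial hrs (by omega), if_neg hrp',
    if_neg hrp]
  simp

end Bidegree

end ExteriorDerivative

/-! ### Pullback of differential forms -/

section AlternatingPullback

variable {E F G W : Type*} [NormedAddCommGroup E] [NormedSpace ℝ E]
  [NormedAddCommGroup F] [NormedSpace ℝ F] [NormedAddCommGroup G] [NormedSpace ℝ G]
  [NormedAddCommGroup W] [NormedSpace ℝ W] {k : ℕ}

open Equiv.Perm (sign) in
theorem norm_alternatization_le (f : ContinuousMultilinearMap ℝ (fun _ : Fin k ↦ E) G) :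
    ‖ContinuousMultilinearMap.alternatization f‖ ≤ k.factorial * ‖f‖ := by
  refine ContinuousAlternatingMap.opNorm_le_bound _ (by positivity) fun v ↦ ?_
  have norm_le (σ : Equiv.Perm (Fin k)) : ‖sign σ • f (v ∘ σ)‖ ≤ ‖f‖ * ∏ i, ‖v i‖ := by
    have norm_sign_smul : ‖sign σ • f (v ∘ σ)‖ = ‖f (v ∘ σ)‖ := by
      rcases Int.units_eq_one_or (sign σ) with h | h <;> simp [h, Units.smul_def]
    rw [norm_sign_smul, ← Equiv.prod_comp σ fun i ↦ ‖v i‖]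
    exact f.le_opNorm _
  rw [ContinuousMultilinearMap.alternatization_apply_apply]
  exact (norm_sum_le_of_le _ fun σ _ ↦ norm_le σ).trans_eq
    (by simp [Fintype.card_perm, mul_assoc])

/-- Alternatization of continuous multilinear maps as a continuous linear map. -/
def alternatizationCLM (E G : Type*) [NormedAddCommGroup E] [NormedSpace ℝ E]
    [NormedAddCommGroup G] [NormedSpace ℝ G] (k : ℕ) :
    ContinuousMultilinearMap ℝ (fun _ : Fin k ↦ E) G →L[ℝ] E [⋀^Fin k]→L[ℝ] G :=
  LinearMap.mkContinuous
    { toFun := fun f ↦ ContinuousMultilinearMap.alternatization f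
      map_add' := fun f g ↦ map_add _ f g
      map_smul' := fun c f ↦ by
        ext v
        simp [ContinuousMultilinearMap.alternatization_apply_apply, Finset.smul_sum,
          smul_comm c] }
    k.factorial norm_alternatization_le

theorem alternatizationCLM_toContinuousMultilinearMap (f : E [⋀^Fin k]→L[ℝ] G) :
    alternatizationCLM E G k f.toContinuousMultilinearMap = (k.factorial : ℝ) • f := by
  ext v
  have sign_smul (σ : Equiv.Perm (Fin k)) : Equiv.Perm.sign σ • f (v ∘ σ) = f v := by
    have h := f.toAlternatingMap.map_perm v σ
    rw [ContinuousAlternatingMap.coe_toAlternatingMap] at h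
    rw [h, smul_smul, Int.units_mul_self, one_smul]
  change ContinuousMultilinearMap.alternatization f.toContinuousMultilinearMap v = _
  simp [ContinuousMultilinearMap.alternatization_apply_apply, sign_smul, Fintype.card_perm,
    ← Nat.cast_smul_eq_nsmul ℝ]

-- Alternating maps are a retract of multilinear maps, where the pullback is a polynomial map.
theorem contDiffAt_alternating_compContinuousLinearMap {r : WithTop ℕ∞}
    {f : W → F [⋀^Fin k]→L[ℝ] G} {g : W → E →L[ℝ] F} {z : W}
    (hf : ContDiffAt ℝ r f z) (hg : ContDiffAt ℝ r g z) :
    ContDiffAt ℝ r (fun y ↦ (f y).compContinuousLinearMap (g y)) z := by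
  have multilinear : ContDiffAt ℝ r (fun y ↦
      (ContinuousMultilinearMap.compContinuousLinearMapContinuousMultilinear ℝ
        (fun _ : Fin k ↦ E) (fun _ ↦ F) G (fun _ ↦ g y)) (f y).toContinuousMultilinearMap) z :=
    ((ContinuousMultilinearMap.contDiff _).contDiffAt.comp z
      (contDiffAt_pi.2 fun _ ↦ hg)).clm_apply
        ((ContinuousAlternatingMap.toContinuousMultilinearMapCLM ℝ :
          (F [⋀^Fin k]→L[ℝ] G) →L[ℝ] _).contDiff.contDiffAt.comp z hf)
  have alternating := ((alternatizationCLM E G k).contDiff.contDiffAt.comp z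
    multilinear).const_smul ((k.factorial : ℝ)⁻¹)
  refine alternating.congr_of_eventuallyEq (Filter.Eventually.of_forall fun y ↦ ?_)
  have retract := congrArg ((k.factorial : ℝ)⁻¹ • ·)
    (alternatizationCLM_toContinuousMultilinearMap ((f y).compContinuousLinearMap (g y)))
  simp only [inv_smul_smul₀ (Nat.cast_ne_zero.2 k.factorial_ne_zero : (k.factorial : ℝ) ≠ 0)]
    at retract
  exact retract.symm

theorem contDiffAt_extDeriv {f : W → W [⋀^Fin k]→L[ℝ] G} {z : W} (hf : ContDiffAt ℝ ∞ f z) :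
    ContDiffAt ℝ ∞ (extDeriv f) z :=
  (ContinuousAlternatingMap.alternatizeUncurryFinCLM ℝ W G).contDiff.contDiffAt.comp z
    (hf.fderiv_right (by simp))

end AlternatingPullback

namespace DiffForm

variable {m : ℕ} {M : Type*} [TopologicalSpace M] [ChartedSpace (EuclideanSpace ℝ (Fin m)) M]
  {𝕜 : Type*} [RCLike 𝕜] {k : ℕ}
  {V W : Type*} [NormedAddCommGroup V] [NormedSpace ℝ V] [NormedAddCommGroup W] [NormedSpace ℝ W]

theorem isSmooth_sum {κ : Type*} {s : Finset κ} {α : κ → DiffForm m M 𝕜 k}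
    (hα : ∀ i ∈ s, (α i).IsSmooth) : (∑ i ∈ s, α i).IsSmooth :=
  Finset.sum_induction _ _ (fun _ _ ↦ IsSmooth.add) isSmooth_zero hα

theorem d_sum {κ : Type*} {s : Finset κ} {α : κ → DiffForm m M 𝕜 k}
    (hα : ∀ i ∈ s, (α i).IsSmooth) : (∑ i ∈ s, α i).d = ∑ i ∈ s, (α i).d := by
  classical
  induction s using Finset.induction_on with
  | empty => exact d_zero
  | insert i s hi ih =>
    obtain ⟨hi', hs⟩ := (Finset.forall_mem_insert _ _ _).1 hα
    rw [Finset.sum_insert hi, Finset.sum_insert hi, d_add hi' (isSmooth_sum hs), ih hs]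

/-- The pullback of a form on `M` under a map `σ` from a normed space to `M`. The normed space
may be infinite-dimensional, so that the pullback is a field of alternating maps and not a
`DiffForm`. -/
def pullback (α : DiffForm m M 𝕜 k) (σ : W → M) : W → W [⋀^Fin k]→L[ℝ] 𝕜 :=
  fun z ↦ (α (σ z)).compContinuousLinearMap (mfderiv 𝓘(ℝ, W) (𝓡 m) σ z)

theorem pullback_apply (α : DiffForm m M 𝕜 k) (σ : W → M) (z : W) (v : Fin k → W) :
    α.pullback σ z v = α (σ z) (fun j ↦ mfderiv 𝓘(ℝ, W) (𝓡 m) σ z (v j)) := rfl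

theorem pullback_extChartAt_symm (α : DiffForm m M 𝕜 k) (x : M) :
    α.pullback (extChartAt (𝓡 m) x).symm = α.inChart x := rfl

theorem pullback_congr (α : DiffForm m M 𝕜 k) {σ τ : W → M} {z : W}
    (h : σ =ᶠ[nhds z] τ) : α.pullback σ z = α.pullback τ z := by
  have h_apply (v : Fin k → EuclideanSpace ℝ (Fin m)) : α (σ z) v = α (τ z) v := by
    rw [h.self_of_nhds]
  ext v
  simp only [pullback_apply]
  rw [h.mfderiv_eq (I := 𝓘(ℝ, W)) (I' := 𝓡 m)]
  exact h_apply _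

theorem pullback_comp (α : DiffForm m M 𝕜 k) {σ : W → M} {g : V → W} {z : V}
    (hσ : MDifferentiableAt 𝓘(ℝ, W) (𝓡 m) σ (g z)) (hg : DifferentiableAt ℝ g z) :
    α.pullback (σ ∘ g) z = (α.pullback σ (g z)).compContinuousLinearMap (fderiv ℝ g z) := by
  ext v
  simp only [pullback_apply, ContinuousAlternatingMap.compContinuousLinearMap_apply]
  rw [mfderiv_comp z hσ hg.mdifferentiableAt, mfderiv_eq_fderiv]
  rfl

theorem pullback_eventuallyEq_of_comp (α : DiffForm m M 𝕜 k) {σ : V → M} {ρ : W → M} {g : V → W}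
    {z : V} (hg : ContDiffAt ℝ ∞ g z)
    (hρ : ∀ᶠ y in nhds (g z), MDifferentiableAt 𝓘(ℝ, W) (𝓡 m) ρ y) (h : ρ ∘ g =ᶠ[nhds z] σ) :
    α.pullback σ =ᶠ[nhds z] fun y ↦
      (α.pullback ρ (g y)).compContinuousLinearMap (fderiv ℝ g y) := by
  filter_upwards [h.eventually_nhds, (hg.of_le (m := 1) (by simp)).eventually (by simp),
    hg.continuousAt.eventually hρ] with y hy hgy hρy
  rw [← pullback_comp _ hρy (hgy.differentiableAt (by simp))]
  exact (α.pullback_congr hy).symm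

theorem IsSmooth.contDiffAt_inChart {α : DiffForm m M 𝕜 k} (hα : α.IsSmooth) {x₀ : M}
    {z : EuclideanSpace ℝ (Fin m)} (hz : z ∈ (extChartAt (𝓡 m) x₀).target) :
    ContDiffAt ℝ ∞ (α.inChart x₀) z :=
  (hα x₀).contDiffAt ((isOpen_extChartAt_target (I := 𝓡 m) x₀).mem_nhds hz)

theorem contDiffAt_extChartAt_comp {σ : W → M} {z : W}
    (hσ : ContMDiffAt 𝓘(ℝ, W) (𝓡 m) ∞ σ z) :
    ContDiffAt ℝ ∞ (extChartAt (𝓡 m) (σ z) ∘ σ) z :=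
  ((contMDiffAt_extChartAt (n := ∞) (I := 𝓡 m) (x := σ z)).comp z hσ).contDiffAt

variable [IsManifold (𝓡 m) ∞ M]

theorem contMDiffAt_extChartAt_symm {x₀ : M} {z : EuclideanSpace ℝ (Fin m)}
    (hz : z ∈ (extChartAt (𝓡 m) x₀).target) :
    ContMDiffAt (𝓡 m) (𝓡 m) ∞ (extChartAt (𝓡 m) x₀).symm z :=
  (contMDiffOn_extChartAt_symm (n := ∞) (I := 𝓡 m) x₀).contMDiffAt
    ((isOpen_extChartAt_target (I := 𝓡 m) x₀).mem_nhds hz)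

theorem pullback_eventuallyEq_inChart (α : DiffForm m M 𝕜 k) {σ : W → M} {z : W}
    (hσ : ContMDiffAt 𝓘(ℝ, W) (𝓡 m) ∞ σ z) :
    α.pullback σ =ᶠ[nhds z] fun y ↦
      (α.inChart (σ z) ((extChartAt (𝓡 m) (σ z) ∘ σ) y)).compContinuousLinearMap
        (fderiv ℝ (extChartAt (𝓡 m) (σ z) ∘ σ) y) := by
  refine pullback_eventuallyEq_of_comp (ρ := (extChartAt (𝓡 m) (σ z)).symm) α
    (contDiffAt_extChartAt_comp hσ) ?_ ?_
  · filter_upwards [extChartAt_target_mem_nhds (I := 𝓡 m) (σ z)] with y hy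
    exact (contMDiffAt_extChartAt_symm hy).mdifferentiableAt (by simp)
  · filter_upwards [hσ.continuousAt.eventually (extChartAt_source_mem_nhds (I := 𝓡 m) (σ z))]
      with y hy
    exact (extChartAt (𝓡 m) (σ z)).left_inv hy

theorem IsSmooth.contDiffAt_pullback {α : DiffForm m M 𝕜 k} (hα : α.IsSmooth) {σ : W → M} {z : W}
    (hσ : ContMDiffAt 𝓘(ℝ, W) (𝓡 m) ∞ σ z) : ContDiffAt ℝ ∞ (α.pullback σ) z :=
  have hg := contDiffAt_extChartAt_comp hσ
  (contDiffAt_alternating_compContinuousLinearMap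
    (ContDiffAt.comp (g := α.inChart (σ z)) z
      (hα.contDiffAt_inChart (mem_extChartAt_target (I := 𝓡 m) (σ z))) hg)
    (hg.fderiv_right (by simp))).congr_of_eventuallyEq (α.pullback_eventuallyEq_inChart hσ)

theorem IsSmooth.pullback_d {α : DiffForm m M 𝕜 k} (hα : α.IsSmooth) {σ : W → M} {z : W}
    (hσ : ContMDiffAt 𝓘(ℝ, W) (𝓡 m) ∞ σ z) : α.d.pullback σ z = extDeriv (α.pullback σ) z := by
  rw [(α.pullback_eventuallyEq_inChart hσ).extDeriv_eq, extDeriv_pullback (r := ∞)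
    (f := extChartAt (𝓡 m) (σ z) ∘ σ) (hα.differentiableAt (σ z)) (contDiffAt_extChartAt_comp hσ)
    (minSmoothness_of_isRCLikeNormedField.le.trans (WithTop.coe_le_coe.2 le_top))]
  ext v
  simp only [pullback_apply, d, ContinuousAlternatingMap.compContinuousLinearMap_apply]
  rw [← mfderiv_eq_fderiv, mfderiv_comp z
    ((contMDiffAt_extChartAt (n := ∞) (I := 𝓡 m) (x := σ z)).mdifferentiableAt (by simp))
    (hσ.mdifferentiableAt (by simp))]
  rfl

theorem IsSmooth.inChart_d_eventuallyEq {α : DiffForm m M 𝕜 k} (hα : α.IsSmooth) {x₀ : M}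
    {z : EuclideanSpace ℝ (Fin m)} (hz : z ∈ (extChartAt (𝓡 m) x₀).target) :
    α.d.inChart x₀ =ᶠ[nhds z] extDeriv (α.inChart x₀) := by
  filter_upwards [(isOpen_extChartAt_target (I := 𝓡 m) x₀).mem_nhds hz] with y hy
  exact hα.pullback_d (contMDiffAt_extChartAt_symm hy)

theorem IsSmooth.d {α : DiffForm m M 𝕜 k} (hα : α.IsSmooth) : α.d.IsSmooth := fun _ _ hz ↦
  ((contDiffAt_extDeriv (hα.contDiffAt_inChart hz)).congr_of_eventuallyEq
    (hα.inChart_d_eventuallyEq hz)).contDiffWithinAt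

theorem IsSmooth.d_d {α : DiffForm m M 𝕜 k} (hα : α.IsSmooth) : α.d.d = 0 := by
  funext x
  have hx := mem_extChartAt_target (I := 𝓡 m) x
  have extDeriv_inChart_d : extDeriv (α.d.inChart x) (extChartAt (𝓡 m) x x) = 0 := by
    rw [(hα.inChart_d_eventuallyEq hx).extDeriv_eq]
    exact extDeriv_extDeriv_apply (hα.contDiffAt_inChart hx)
      (minSmoothness_of_isRCLikeNormedField.le.trans (WithTop.coe_le_coe.2 le_top))
  change (extDeriv (α.d.inChart x) (extChartAt (𝓡 m) x x)).compContinuousLinearMap _ = 0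
  rw [extDeriv_inChart_d]
  rfl

theorem isSmooth_of_forall_exists_chart {α : DiffForm m M 𝕜 k}
    (h : ∀ x : M, ∃ (C : Type) (_ : NormedAddCommGroup C) (_ : NormedSpace ℝ C)
      (Φ : OpenPartialHomeomorph M C), x ∈ Φ.source ∧
        ContMDiffOn (𝓡 m) 𝓘(ℝ, C) ∞ Φ Φ.source ∧ ContMDiffOn 𝓘(ℝ, C) (𝓡 m) ∞ Φ.symm Φ.target ∧
        ContDiffOn ℝ ∞ (α.pullback Φ.symm) Φ.target) : α.IsSmooth := by
  intro x₀ z hz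
  set e := (extChartAt (𝓡 m) x₀).symm
  have hez : ContMDiffAt (𝓡 m) (𝓡 m) ∞ e z := contMDiffAt_extChartAt_symm hz
  obtain ⟨C, _, _, Φ, hx, hΦ, hΦ', hα⟩ := h (e z)
  have source_mem : Φ.source ∈ nhds (e z) := Φ.open_source.mem_nhds hx
  have target_mem : Φ.target ∈ nhds (Φ (e z)) := Φ.open_target.mem_nhds (Φ.map_source hx)
  have hg : ContDiffAt ℝ ∞ (Φ ∘ e) z := ((hΦ.contMDiffAt source_mem).comp z hez).contDiffAt
  have inChart_eq : α.inChart x₀ =ᶠ[nhds z] fun y ↦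
      (α.pullback Φ.symm ((Φ ∘ e) y)).compContinuousLinearMap (fderiv ℝ (Φ ∘ e) y) := by
    rw [← pullback_extChartAt_symm]
    refine α.pullback_eventuallyEq_of_comp hg ?_ ?_
    · filter_upwards [target_mem] with y hy
      exact (hΦ'.contMDiffAt (Φ.open_target.mem_nhds hy)).mdifferentiableAt (by simp)
    · filter_upwards [hez.continuousAt.eventually source_mem] with y hy
      exact Φ.left_inv hy
  exact ((contDiffAt_alternating_compContinuousLinearMap
    (ContDiffAt.comp (g := α.pullback Φ.symm) z (hα.contDiffAt target_mem) hg)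
    (hg.fderiv_right (by simp))).congr_of_eventuallyEq inChart_eq).contDiffWithinAt

end DiffForm

/-! ### Charts adapted to the foliation -/

section SubmersionCharts

universe u

variable {𝕜 : Type*} [NontriviallyNormedField 𝕜] {E : Type u} [NormedAddCommGroup E]
  [NormedSpace 𝕜 E] {E' : Type*} [NormedAddCommGroup E'] [NormedSpace 𝕜 E']
  {M N : Type*} [TopologicalSpace M] [ChartedSpace E M] [TopologicalSpace N] [ChartedSpace E' N]
  {r : WithTop ℕ∞} {f : M → N} {x : M}

theorem contDiffOn_symm_trans_of_mem_maximalAtlas {φ ψ : OpenPartialHomeomorph N E'}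
    (hφ : φ ∈ IsManifold.maximalAtlas 𝓘(𝕜, E') r N)
    (hψ : ψ ∈ IsManifold.maximalAtlas 𝓘(𝕜, E') r N) :
    ContDiffOn 𝕜 r (φ.symm ≫ₕ ψ) (φ.symm ≫ₕ ψ).source :=
  (contMDiffOn_of_mem_contDiffGroupoid
    (StructureGroupoid.compatible_of_mem_maximalAtlas hφ hψ)).contDiffOn

theorem exists_openPartialHomeomorph_fst_eq_of_isSubmersionAt
    (hf : Manifold.IsSubmersionAt 𝓘(𝕜, E) 𝓘(𝕜, E') r f x)
    {χ : OpenPartialHomeomorph N E'} (hχ : χ ∈ IsManifold.maximalAtlas 𝓘(𝕜, E') r N)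
    (hx : f x ∈ χ.source) :
    ∃ (C : Type u) (_ : NormedAddCommGroup C) (_ : NormedSpace 𝕜 C)
      (Φ : OpenPartialHomeomorph M (E' × C)), x ∈ Φ.source ∧
        ContMDiffOn 𝓘(𝕜, E) 𝓘(𝕜, E' × C) r Φ Φ.source ∧
        ContMDiffOn 𝓘(𝕜, E' × C) 𝓘(𝕜, E) r Φ.symm Φ.target ∧
        ∀ y ∈ Φ.source, f y ∈ χ.source ∧ (Φ y).1 = χ (f y) := by
  let φ := hf.domChart
  let ψ := hf.codChart
  let L := hf.equiv
  let T : OpenPartialHomeomorph (E' × hf.complement) (E' × hf.complement) :=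
    (ψ.symm ≫ₕ χ).prod (OpenPartialHomeomorph.refl _)
  let Φ : OpenPartialHomeomorph M (E' × hf.complement) := φ.transHomeomorph L.toHomeomorph ≫ₕ T
  have hT : ContDiffOn 𝕜 r T T.source :=
    (contDiffOn_symm_trans_of_mem_maximalAtlas hf.codChart_mem_maximalAtlas hχ).prodMap
      contDiffOn_id
  have hT_symm : ContDiffOn 𝕜 r T.symm T.target :=
    (contDiffOn_symm_trans_of_mem_maximalAtlas hχ hf.codChart_mem_maximalAtlas).prodMap
      contDiffOn_id
  have hfst (y : M) (hy : y ∈ φ.source) : (L (φ y)).1 = ψ (f y) := by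
    have hφy : φ y ∈ (φ.extend 𝓘(𝕜, E)).target := by simpa using φ.map_source hy
    simpa [φ, hf.domChart.left_inv hy] using (hf.writtenInCharts hφy).symm
  have hfψ (y : M) (hy : y ∈ φ.source) : f y ∈ ψ.source := hf.source_subset_preimage_source hy
  have hsource (y : M) : y ∈ Φ.source ↔ y ∈ φ.source ∧ f y ∈ χ.source := by
    simp +contextual [Φ, T, hfst, hfψ, ψ.left_inv]
  refine ⟨hf.complement, inferInstance, inferInstance, Φ,
    (hsource x).2 ⟨hf.mem_domChart_source, hx⟩, ?_, ?_, fun y hy ↦ ⟨((hsource y).1 hy).2, ?_⟩⟩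
  · exact hT.contMDiffOn.comp (L.contDiff.contMDiff.comp_contMDiffOn
      ((contMDiffOn_of_mem_maximalAtlas hf.domChart_mem_maximalAtlas).mono
        Set.inter_subset_left)) Set.inter_subset_right
  · exact (contMDiffOn_symm_of_mem_maximalAtlas hf.domChart_mem_maximalAtlas).comp
      (L.symm.contDiff.contMDiff.comp_contMDiffOn (hT_symm.contMDiffOn.mono
        Set.inter_subset_left)) Set.inter_subset_right
  · have hyφ := ((hsource y).1 hy).1
    change χ (ψ.symm (L (φ y)).1) = χ (f y)
    rw [hfst y hyφ, ψ.left_inv (hfψ y hyφ)]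

end SubmersionCharts

section RealStructure

variable {E E' N N' : Type*} [NormedAddCommGroup E] [NormedSpace ℂ E]
  [NormedAddCommGroup E'] [NormedSpace ℂ E']
  [TopologicalSpace N] [ChartedSpace E N] [TopologicalSpace N'] [ChartedSpace E' N']

theorem isManifold_real_of_complex [IsManifold 𝓘(ℂ, E) ω N] : IsManifold 𝓘(ℝ, E) ∞ N := by
  refine isManifold_of_contDiffOn _ _ _ fun e e' he he' ↦ ?_
  have h := (contDiffGroupoid ω 𝓘(ℂ, E)).compatible he he'
  rw [contDiffGroupoid, mem_groupoid_of_pregroupoid] at h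
  exact (h.1.restrict_scalars ℝ).of_le le_top

theorem hasMFDerivAt_real_of_complex {g : N → N'} {y : N}
    (h : MDifferentiableAt 𝓘(ℂ, E) 𝓘(ℂ, E') g y) :
    HasMFDerivAt 𝓘(ℝ, E) 𝓘(ℝ, E') g y
      ((mfderiv 𝓘(ℂ, E) 𝓘(ℂ, E') g y : E →L[ℂ] E').restrictScalars ℝ : E →L[ℝ] E') :=
  ⟨h.hasMFDerivAt.1, HasFDerivWithinAt.restrictScalars ℝ h.hasMFDerivAt.2⟩

end RealStructure

namespace TransverselyHolomorphicFoliation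

variable {m n : ℕ} {M T₀ ι : Type*}
  [TopologicalSpace M] [ChartedSpace (EuclideanSpace ℝ (Fin m)) M]
  [TopologicalSpace T₀] [ChartedSpace (EuclideanSpace ℂ (Fin n)) T₀]

section Differential

variable (F : TransverselyHolomorphicFoliation m n M T₀ ι)

theorem exists_mem (x : M) : ∃ i, x ∈ F.U i :=
  Set.mem_iUnion.1 (F.cover ▸ Set.mem_univ x)

theorem exists_df_eq {i j : ι} {x : M} (hi : x ∈ F.U i) (hj : x ∈ F.U j) :
    ∃ A : EuclideanSpace ℂ (Fin n) →ₗ[ℂ] EuclideanSpace ℂ (Fin n),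
      ∀ v, F.df j x v = A (F.df i x v) := by
  have hcocycle : F.f j =ᶠ[nhds x] F.γ i j ∘ F.f i := by
    filter_upwards [(F.isOpen_U i).mem_nhds hi, (F.isOpen_U j).mem_nhds hj] with y hy hy'
    exact F.cocycle i j y ⟨hy, hy'⟩
  have hγ := F.holomorphic i j (F.f i x) ⟨x, ⟨hi, hj⟩, rfl⟩
  have hf := ((F.submersion i x hi).contMDiffAt.mdifferentiableAt (by simp)).hasMFDerivAt
  let A : EuclideanSpace ℂ (Fin n) →L[ℂ] EuclideanSpace ℂ (Fin n) :=
    mfderiv 𝓘(ℂ, EuclideanSpace ℂ (Fin n)) 𝓘(ℂ, EuclideanSpace ℂ (Fin n)) (F.γ i j) (F.f i x)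
  refine ⟨A, fun v ↦ ?_⟩
  rw [df, hcocycle.mfderiv_eq,
    (HasMFDerivAt.comp x (hasMFDerivAt_real_of_complex hγ) hf).mfderiv]
  rfl

theorem isTangent_iff {i : ι} {x : M} (hi : x ∈ F.U i) (v : TangentSpace (𝓡 m) x) :
    F.IsTangent x v ↔ F.df i x v = 0 := by
  refine ⟨fun h ↦ h i hi, fun h j hj ↦ ?_⟩
  obtain ⟨A, hA⟩ := F.exists_df_eq hi hj
  rw [hA, h, map_zero]

end Differential

/-- A chart of `M` inside `U i` whose first component is the submersion `f i` read in a holomorphic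
chart of `T₀`: it turns the leaves into the fibres of the first projection of `ℂⁿ × C`, and the
transverse complex structure into that of `ℂⁿ`. -/
structure AdaptedChart (F : TransverselyHolomorphicFoliation m n M T₀ ι) (i : ι) where
  Complement : Type
  [normedAddCommGroup : NormedAddCommGroup Complement]
  [normedSpace : NormedSpace ℝ Complement]
  toChart : OpenPartialHomeomorph M (EuclideanSpace ℂ (Fin n) × Complement)
  contMDiffOn : ContMDiffOn (𝓡 m) 𝓘(ℝ, EuclideanSpace ℂ (Fin n) × Complement) ∞ toChart
    toChart.source
  contMDiffOn_symm : ContMDiffOn 𝓘(ℝ, EuclideanSpace ℂ (Fin n) × Complement) (𝓡 m) ∞ toChart.symm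
    toChart.target
  transverse : OpenPartialHomeomorph T₀ (EuclideanSpace ℂ (Fin n))
  transverse_mem_atlas : transverse ∈ atlas (EuclideanSpace ℂ (Fin n)) T₀
  source_subset : toChart.source ⊆ F.U i
  mapsTo_source : Set.MapsTo (F.f i) toChart.source transverse.source
  fst_apply : ∀ y ∈ toChart.source, (toChart y).1 = transverse (F.f i y)

namespace AdaptedChart

attribute [instance] normedAddCommGroup normedSpace

variable {F : TransverselyHolomorphicFoliation m n M T₀ ι} {i : ι} (Φ : F.AdaptedChart i)

/-- The model space `ℂⁿ × C` of an adapted chart. -/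
abbrev Model := EuclideanSpace ℂ (Fin n) × Φ.Complement

/-- The projection of the model space along the leaves. -/
def proj : Φ.Model →ₗ[ℝ] EuclideanSpace ℂ (Fin n) :=
  LinearMap.fst ℝ (EuclideanSpace ℂ (Fin n)) Φ.Complement

/-- A lift to the model space of the multiplication by `I` on `ℂⁿ`. -/
def J : Φ.Model →L[ℝ] Φ.Model :=
  ((Complex.I • ContinuousLinearMap.id ℂ (EuclideanSpace ℂ (Fin n))).restrictScalars ℝ).prodMap 0

theorem proj_J (v : Φ.Model) : Φ.proj (Φ.J v) = Complex.I • Φ.proj v := rfl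

variable {z : Φ.Model}

theorem symm_mem (hz : z ∈ Φ.toChart.target) : Φ.toChart.symm z ∈ F.U i :=
  Φ.source_subset (Φ.toChart.map_target hz)

theorem contMDiffAt_symm (hz : z ∈ Φ.toChart.target) :
    ContMDiffAt 𝓘(ℝ, Φ.Model) (𝓡 m) ∞ Φ.toChart.symm z :=
  Φ.contMDiffOn_symm.contMDiffAt (Φ.toChart.open_target.mem_nhds hz)

/-- The differential of the inverse of an adapted chart. -/
def mfderivSymm (hz : z ∈ Φ.toChart.target) :
    Φ.Model ≃L[ℝ] TangentSpace (𝓡 m) (Φ.toChart.symm z) :=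
  OpenPartialHomeomorph.MDifferentiable.mfderiv (I := 𝓘(ℝ, Φ.Model)) (I' := 𝓡 m)
    ⟨Φ.contMDiffOn_symm.mdifferentiableOn (by simp), Φ.contMDiffOn.mdifferentiableOn (by simp)⟩ hz

theorem exists_mfderivSymm_eq {k : ℕ} (hz : z ∈ Φ.toChart.target)
    (v : Fin k → TangentSpace (𝓡 m) (Φ.toChart.symm z)) :
    ∃ w : Fin k → Φ.Model, v = fun l ↦ Φ.mfderivSymm hz (w l) :=
  ⟨fun l ↦ (Φ.mfderivSymm hz).symm (v l), by simp⟩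

theorem exists_df_mfderivSymm_eq [IsManifold 𝓘(ℂ, EuclideanSpace ℂ (Fin n)) ω T₀]
    (hz : z ∈ Φ.toChart.target) :
    ∃ B : EuclideanSpace ℂ (Fin n) ≃L[ℂ] EuclideanSpace ℂ (Fin n),
      ∀ v, F.df i (Φ.toChart.symm z) (Φ.mfderivSymm hz v) = B (Φ.proj v) := by
  have hright (w : Φ.Model) (hw : w ∈ Φ.toChart.target) :
      w.1 = Φ.transverse (F.f i (Φ.toChart.symm w)) := by
    rw [← Φ.fst_apply _ (Φ.toChart.map_target hw), Φ.toChart.right_inv hw]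
  have hf (w : Φ.Model) (hw : w ∈ Φ.toChart.target) :
      F.f i (Φ.toChart.symm w) = Φ.transverse.symm w.1 := by
    rw [hright w hw, Φ.transverse.left_inv (Φ.mapsTo_source (Φ.toChart.map_target hw))]
  have hz₁ : z.1 ∈ Φ.transverse.target := by
    rw [hright z hz]
    exact Φ.transverse.map_source (Φ.mapsTo_source (Φ.toChart.map_target hz))
  have hχ : Φ.transverse.MDifferentiable 𝓘(ℂ, EuclideanSpace ℂ (Fin n))
      𝓘(ℂ, EuclideanSpace ℂ (Fin n)) := mdifferentiable_of_mem_atlas Φ.transverse_mem_atlas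
  refine ⟨hχ.symm.mfderiv hz₁, fun v ↦ ?_⟩
  have hcomp := mfderiv_comp z
    ((F.submersion i _ (Φ.symm_mem hz)).contMDiffAt.mdifferentiableAt (by simp))
    ((Φ.contMDiffAt_symm hz).mdifferentiableAt (by simp))
  have hchart : F.f i ∘ Φ.toChart.symm =ᶠ[nhds z] Φ.transverse.symm ∘ Prod.fst :=
    Filter.eventually_of_mem (Φ.toChart.open_target.mem_nhds hz) hf
  have hfst := (HasMFDerivAt.comp z
    (hasMFDerivAt_real_of_complex (hχ.symm.mdifferentiableAt hz₁))
    (hasFDerivAt_fst (𝕜 := ℝ) (p := z)).hasMFDerivAt).mfderiv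
  rw [hchart.mfderiv_eq, hfst] at hcomp
  exact (congrArg (fun L : Φ.Model →L[ℝ] EuclideanSpace ℂ (Fin n) ↦ L v) hcomp).symm

end AdaptedChart

section PullbackToCharts

variable {F : TransverselyHolomorphicFoliation m n M T₀ ι} {i : ι}
  [IsManifold 𝓘(ℂ, EuclideanSpace ℂ (Fin n)) ω T₀]

theorem AdaptedChart.isTangent_mfderivSymm_iff (Φ : F.AdaptedChart i) {z : Φ.Model}
    (hz : z ∈ Φ.toChart.target) (v : Φ.Model) :
    F.IsTangent (Φ.toChart.symm z) (Φ.mfderivSymm hz v) ↔ Φ.proj v = 0 := by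
  obtain ⟨B, hB⟩ := Φ.exists_df_mfderivSymm_eq hz
  rw [F.isTangent_iff (Φ.symm_mem hz), hB, B.map_eq_zero_iff]

theorem AdaptedChart.df_mfderivSymm_eq_smul_iff (Φ : F.AdaptedChart i) {z : Φ.Model}
    (hz : z ∈ Φ.toChart.target) (c : ℂ) (v w : Φ.Model) :
    F.df i (Φ.toChart.symm z) (Φ.mfderivSymm hz w) =
      c • F.df i (Φ.toChart.symm z) (Φ.mfderivSymm hz v) ↔ Φ.proj w = c • Φ.proj v := by
  obtain ⟨B, hB⟩ := Φ.exists_df_mfderivSymm_eq hz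
  rw [hB, hB, ← map_smul, B.injective.eq_iff]

theorem exists_adaptedChart {x : M} (hx : x ∈ F.U i) :
    ∃ (Φ : F.AdaptedChart i) (z : Φ.Model), z ∈ Φ.toChart.target ∧ Φ.toChart.symm z = x := by
  have : IsManifold 𝓘(ℝ, EuclideanSpace ℂ (Fin n)) ∞ T₀ := isManifold_real_of_complex
  obtain ⟨C, _, _, Φ, hxΦ, hΦ, hΦ_symm, hfst⟩ :=
    exists_openPartialHomeomorph_fst_eq_of_isSubmersionAt (F.submersion i x hx)
      (IsManifold.chart_mem_maximalAtlas (F.f i x)) (mem_chart_source _ _)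
  let Ψ : F.AdaptedChart i :=
    { Complement := C
      toChart := Φ.restrOpen (F.U i) (F.isOpen_U i)
      contMDiffOn := hΦ.mono Set.inter_subset_left
      contMDiffOn_symm := hΦ_symm.mono Set.inter_subset_left
      transverse := chartAt _ (F.f i x)
      transverse_mem_atlas := chart_mem_atlas _ _
      source_subset := Set.inter_subset_right
      mapsTo_source := fun y hy ↦ (hfst y hy.1).1
      fst_apply := fun y hy ↦ (hfst y hy.1).2 }
  have hxΨ : x ∈ Ψ.toChart.source := ⟨hxΦ, hx⟩
  exact ⟨Ψ, Ψ.toChart x, Ψ.toChart.map_source hxΨ, Ψ.toChart.left_inv hxΨ⟩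

variable {𝕜 : Type*} [RCLike 𝕜] {k p q : ℕ}

theorem ext_of_pullback_symm {α β : DiffForm m M 𝕜 k}
    (h : ∀ i (Φ : F.AdaptedChart i), ∀ z ∈ Φ.toChart.target,
      α.pullback Φ.toChart.symm z = β.pullback Φ.toChart.symm z) : α = β := by
  funext x
  ext v
  obtain ⟨i, hi⟩ := F.exists_mem x
  obtain ⟨Φ, z, hz, rfl⟩ := exists_adaptedChart hi
  obtain ⟨w, rfl⟩ := Φ.exists_mfderivSymm_eq hz v
  exact congrArg (fun β : Φ.Model [⋀^Fin k]→L[ℝ] 𝕜 ↦ β w) (h i Φ z hz)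

theorem isHorizontal_iff {α : DiffForm m M 𝕜 k} :
    F.IsHorizontal α ↔ ∀ i (Φ : F.AdaptedChart i), ∀ z ∈ Φ.toChart.target,
      HorizontalAlong Φ.proj (α.pullback Φ.toChart.symm z) := by
  refine ⟨fun h i Φ z hz v j hj ↦ h _ _ j ((Φ.isTangent_mfderivSymm_iff hz _).2 hj),
    fun h x v j hj ↦ ?_⟩
  obtain ⟨i, hi⟩ := F.exists_mem x
  obtain ⟨Φ, z, hz, rfl⟩ := exists_adaptedChart hi
  obtain ⟨w, rfl⟩ := Φ.exists_mfderivSymm_eq hz v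
  exact h i Φ z hz w j ((Φ.isTangent_mfderivSymm_iff hz _).1 hj)

theorem isSmooth_of_contDiffOn_pullback_symm [IsManifold (𝓡 m) ∞ M] {α : DiffForm m M 𝕜 k}
    (h : ∀ i (Φ : F.AdaptedChart i),
      ContDiffOn ℝ ∞ (α.pullback Φ.toChart.symm) Φ.toChart.target) : α.IsSmooth := by
  refine DiffForm.isSmooth_of_forall_exists_chart fun x ↦ ?_
  obtain ⟨i, hi⟩ := F.exists_mem x
  obtain ⟨Φ, z, hz, rfl⟩ := exists_adaptedChart hi
  exact ⟨Φ.Model, inferInstance, inferInstance, Φ.toChart, Φ.toChart.map_target hz, Φ.contMDiffOn,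
    Φ.contMDiffOn_symm, h i Φ⟩

theorem mem_typeForms_iff {α : DiffForm m M ℂ k} :
    α ∈ F.typeForms k p q ↔ α ∈ F.basicForms ℂ k ∧
      ∀ i (Φ : F.AdaptedChart i), ∀ z ∈ Φ.toChart.target,
        HasBidegree Φ.proj p q (α.pullback Φ.toChart.symm z) := by
  refine and_congr_right fun _ ↦ ⟨fun h i Φ z hz c v w hvw ↦ h i _ (Φ.symm_mem hz) c _ _ fun l ↦
    (Φ.df_mfderivSymm_eq_smul_iff hz c _ _).2 (hvw l), fun h i x hx c v w hvw ↦ ?_⟩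
  obtain ⟨Φ, z, hz, rfl⟩ := exists_adaptedChart hx
  obtain ⟨v, rfl⟩ := Φ.exists_mfderivSymm_eq hz v
  obtain ⟨w, rfl⟩ := Φ.exists_mfderivSymm_eq hz w
  exact h i Φ z hz c v w fun l ↦ (Φ.df_mfderivSymm_eq_smul_iff hz c _ _).1 (hvw l)

end PullbackToCharts

/-! ### The type decomposition of basic forms -/

variable {F : TransverselyHolomorphicFoliation m n M T₀ ι} {k p q : ℕ}

section Component

variable [IsManifold 𝓘(ℂ, EuclideanSpace ℂ (Fin n)) ω T₀] (F)

theorem exists_transverseJ (x : M) :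
    ∃ J : TangentSpace (𝓡 m) x →L[ℝ] TangentSpace (𝓡 m) x,
      ∀ i, x ∈ F.U i → ∀ v, F.df i x (J v) = Complex.I • F.df i x v := by
  obtain ⟨i, hi⟩ := F.exists_mem x
  obtain ⟨Φ, z, hz, rfl⟩ := exists_adaptedChart hi
  let e := Φ.mfderivSymm hz
  refine ⟨e ∘L Φ.J ∘L e.symm, fun j hj v ↦ ?_⟩
  obtain ⟨A, hA⟩ := F.exists_df_eq hi hj
  obtain ⟨w, rfl⟩ := e.surjective v
  have hw : F.df i _ (e (Φ.J w)) = Complex.I • F.df i _ (e w) :=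
    (Φ.df_mfderivSymm_eq_smul_iff hz _ _ _).2 (Φ.proj_J w)
  simp [hA, hw]

/-- A lift to the tangent space of the transverse complex structure; two lifts differ by vectors
tangent to the leaves, which horizontal forms do not see. -/
def transverseJ (x : M) : TangentSpace (𝓡 m) x →L[ℝ] TangentSpace (𝓡 m) x :=
  (F.exists_transverseJ x).choose

theorem df_transverseJ {i : ι} {x : M} (hi : x ∈ F.U i) (v : TangentSpace (𝓡 m) x) :
    F.df i x (F.transverseJ x v) = Complex.I • F.df i x v :=
  (F.exists_transverseJ x).choose_spec i hi v

/-- The projection of basic forms of degree `k = p + q` onto their component of type `(p, q)`. -/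
def component (k p q : ℕ) : DiffForm m M ℂ k →+ DiffForm m M ℂ k where
  toFun α x := typeComponent (F.transverseJ x) p q (α x)
  map_zero' := funext fun _ ↦ map_zero _
  map_add' _ _ := funext fun _ ↦ map_add _ _ _

theorem sum_component (α : DiffForm m M ℂ k) :
    ∑ x ∈ antidiagonal k, F.component k x.1 x.2 α = α := by
  funext x
  exact (Finset.sum_apply x (antidiagonal k) fun c x ↦ F.component k c.1 c.2 α x).trans
    (sum_typeComponent (F.transverseJ x) (α x))

variable {F} {α : DiffForm m M ℂ k}

theorem component_of_mem_typeForms {r s : ℕ} (hα : α ∈ F.typeForms k r s) (hrs : r + s = k)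
    (hpq : p + q = k) : F.component k p q α = if p = r then α else 0 := by
  funext x
  obtain ⟨i, hi⟩ := F.exists_mem x
  have hx : HasBidegree (F.df i x).toLinearMap r s (α x) := hα.2 i x hi
  refine (hx.typeComponent_eq (F.df_transverseJ hi) hrs hpq).trans ?_
  split_ifs <;> rfl

theorem component_mem_of_mem_iSup {A : ℕ → ℕ → Submodule ℂ (DiffForm m M ℂ k)}
    (hA : ∀ p q, p + q = k → A p q ≤ F.typeForms k p q)
    (hα : α ∈ ⨆ x : antidiagonal k, A x.1.1 x.1.2) (hpq : p + q = k) :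
    F.component k p q α ∈ A p q := by
  induction hα using Submodule.iSup_induction' with
  | mem x β hβ =>
    have hx := mem_antidiagonal.1 x.2
    rw [component_of_mem_typeForms (hA _ _ hx hβ) hx hpq]
    split_ifs with hp
    · rwa [hp, show q = x.1.2 by omega]
    · exact zero_mem _
  | zero => rw [map_zero]; exact zero_mem _
  | add β γ _ _ hβ hγ => rw [map_add]; exact add_mem hβ hγ

variable {i : ι} (Φ : F.AdaptedChart i) {z : Φ.Model}

theorem IsHorizontal.pullback_component (hα : F.IsHorizontal α) (hz : z ∈ Φ.toChart.target)
    (p q : ℕ) : (F.component k p q α).pullback Φ.toChart.symm z =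
      typeComponent Φ.J p q (α.pullback Φ.toChart.symm z) := by
  have hi := Φ.symm_mem hz
  have hx : HorizontalAlong (F.df i (Φ.toChart.symm z)).toLinearMap (α (Φ.toChart.symm z)) :=
    fun v j hv ↦ hα _ v j ((F.isTangent_iff hi _).2 hv)
  exact typeComponent_compContinuousLinearMap (σ := (Φ.mfderivSymm hz).toContinuousLinearMap) hx
    (F.df_transverseJ hi) (fun w ↦ (Φ.df_mfderivSymm_eq_smul_iff hz _ _ _).2 (Φ.proj_J w)) p q

theorem IsHorizontal.pullback_component_eventuallyEq (hα : F.IsHorizontal α)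
    (hz : z ∈ Φ.toChart.target) (p q : ℕ) :
    (F.component k p q α).pullback Φ.toChart.symm =ᶠ[nhds z]
      fun y ↦ typeComponent Φ.J p q (α.pullback Φ.toChart.symm y) :=
  Filter.eventually_of_mem (Φ.toChart.open_target.mem_nhds hz) fun _ hy ↦
    hα.pullback_component Φ hy p q

theorem IsHorizontal.component (hα : F.IsHorizontal α) (p q : ℕ) :
    F.IsHorizontal (F.component k p q α) :=
  isHorizontal_iff.2 fun i Φ z hz ↦ by
    rw [hα.pullback_component Φ hz]
    exact horizontalAlong_typeComponent (isHorizontal_iff.1 hα i Φ z hz) Φ.proj_J p q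

end Component

variable [IsManifold (𝓡 m) ∞ M]

theorem d_mem_basicForms {𝕜 : Type*} [RCLike 𝕜] {α : DiffForm m M 𝕜 k}
    (hα : α ∈ F.basicForms 𝕜 k) : α.d ∈ F.basicForms 𝕜 (k + 1) :=
  ⟨hα.1.d, hα.2.2, by rw [hα.1.d_d]; exact fun _ _ _ _ ↦ rfl⟩

theorem exactForms_le_closedForms (F : TransverselyHolomorphicFoliation m n M T₀ ι)
    (𝕜 : Type*) [RCLike 𝕜] (k : ℕ) : F.exactForms 𝕜 k ≤ F.closedForms 𝕜 k := by
  cases k with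
  | zero => exact bot_le
  | succ k =>
    rintro _ ⟨α, hα, rfl⟩
    exact ⟨d_mem_basicForms hα, hα.1.d_d⟩

variable [IsManifold 𝓘(ℂ, EuclideanSpace ℂ (Fin n)) ω T₀] {α : DiffForm m M ℂ k}

theorem isSmooth_component (hα : α.IsSmooth) (hα_hor : F.IsHorizontal α) (p q : ℕ) :
    (F.component k p q α).IsSmooth :=
  isSmooth_of_contDiffOn_pullback_symm (F := F) fun _ Φ z hz ↦
    (((typeComponent Φ.J p q).contDiff.contDiffAt.comp z
      (hα.contDiffAt_pullback (Φ.contMDiffAt_symm hz))).congr_of_eventuallyEq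
        (hα_hor.pullback_component_eventuallyEq Φ hz p q)).contDiffWithinAt

theorem component_mem_basicForms (hα : α ∈ F.basicForms ℂ k) (p q : ℕ) :
    F.component k p q α ∈ F.basicForms ℂ k := by
  obtain ⟨hsmooth, hhor, hhor_d⟩ := hα
  have hsmooth' := isSmooth_component hsmooth hhor p q
  refine ⟨hsmooth', hhor.component p q, isHorizontal_iff.2 fun i Φ z hz ↦ ?_⟩
  have hz' := Φ.contMDiffAt_symm hz
  rw [hsmooth'.pullback_d hz', (hhor.pullback_component_eventuallyEq Φ hz p q).extDeriv_eq]
  refine horizontalAlong_extDeriv_typeComponent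
    ((hsmooth.contDiffAt_pullback hz').differentiableAt (by simp))
    (Filter.eventually_of_mem (Φ.toChart.open_target.mem_nhds hz) (isHorizontal_iff.1 hhor i Φ))
    Φ.proj_J ?_ p q
  rw [← hsmooth.pullback_d hz']
  exact isHorizontal_iff.1 hhor_d i Φ z hz

theorem component_mem_typeForms (hα : α ∈ F.basicForms ℂ k) (hpq : p + q = k) :
    F.component k p q α ∈ F.typeForms k p q :=
  mem_typeForms_iff.2 ⟨component_mem_basicForms hα p q, fun i Φ z hz ↦ by
    rw [hα.2.1.pullback_component Φ hz]
    exact hasBidegree_typeComponent (isHorizontal_iff.1 hα.2.1 i Φ z hz) Φ.proj_J hpq⟩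

theorem component_d_eq_zero (hα : α ∈ F.typeForms k p q) (hpq : p + q = k) {r s : ℕ}
    (hrs : r + s = k + 1) (hrp : r ≠ p) (hrp' : r ≠ p + 1) : F.component (k + 1) r s α.d = 0 := by
  obtain ⟨⟨hsmooth, -, hhor_d⟩, hbidegree⟩ := mem_typeForms_iff.1 hα
  refine ext_of_pullback_symm (F := F) fun i Φ z hz ↦ ?_
  have hz' := Φ.contMDiffAt_symm hz
  rw [IsHorizontal.pullback_component Φ hhor_d hz, hsmooth.pullback_d hz']
  exact typeComponent_extDeriv_eq_zero
    ((hsmooth.contDiffAt_pullback hz').differentiableAt (by simp))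
    (Filter.eventually_of_mem (Φ.toChart.open_target.mem_nhds hz) (hbidegree i Φ))
    Φ.proj_J hpq hrs hrp hrp'

theorem d_eq_component_add_component (hα : α ∈ F.typeForms k p q) (hpq : p + q = k) :
    α.d = F.component (k + 1) (p + 1) q α.d + F.component (k + 1) p (q + 1) α.d := by
  conv_lhs => rw [← F.sum_component α.d]
  refine Finset.sum_eq_add_of_mem (p + 1, q) (p, q + 1) (by simp; omega) (by simp; omega) (by simp)
    fun x hx hne ↦ ?_
  have hx' := mem_antidiagonal.1 hx
  exact component_d_eq_zero hα hpq hx' (fun h ↦ hne.2 (Prod.ext h (by simp; omega)))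
    fun h ↦ hne.1 (Prod.ext h (by simp; omega))

/-! ### The operators on forms of a given type -/

/-- The operator `∂ : Ω^{p,q} → Ω^{p+1,q}`; on forms that are not of type `(p,q)` its value is
irrelevant. -/
def del (F : TransverselyHolomorphicFoliation m n M T₀ ι) (p q : ℕ) (α : DiffForm m M ℂ k) :
    DiffForm m M ℂ (k + 1) :=
  F.component (k + 1) (p + 1) q α.d

/-- The operator `∂̄ : Ω^{p,q} → Ω^{p,q+1}`; on forms that are not of type `(p,q)` its value is
irrelevant. -/
def delbar (F : TransverselyHolomorphicFoliation m n M T₀ ι) (p q : ℕ) (α : DiffForm m M ℂ k) :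
    DiffForm m M ℂ (k + 1) :=
  F.component (k + 1) p (q + 1) α.d

theorem del_mem_typeForms (hα : α ∈ F.basicForms ℂ k) (hpq : p + q = k) :
    F.del p q α ∈ F.typeForms (k + 1) (p + 1) q :=
  component_mem_typeForms (d_mem_basicForms hα) (by omega)

theorem delbar_mem_typeForms (hα : α ∈ F.basicForms ℂ k) (hpq : p + q = k) :
    F.delbar p q α ∈ F.typeForms (k + 1) p (q + 1) :=
  component_mem_typeForms (d_mem_basicForms hα) (by omega)

theorem d_eq_del_add_delbar (hα : α ∈ F.typeForms k p q) (hpq : p + q = k) :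
    α.d = F.del p q α + F.delbar p q α :=
  d_eq_component_add_component hα hpq

theorem d_del_add_d_delbar (hα : α ∈ F.typeForms k p q) (hpq : p + q = k) :
    (F.del p q α).d + (F.delbar p q α).d = 0 := by
  rw [← DiffForm.d_add (del_mem_typeForms hα.1 hpq).1.1 (delbar_mem_typeForms hα.1 hpq).1.1,
    ← d_eq_del_add_delbar hα hpq, hα.1.1.d_d]

theorem del_delbar_eq_d_delbar (hα : α ∈ F.typeForms k p q) (hpq : p + q = k) :
    F.del p (q + 1) (F.delbar p q α) = (F.delbar p q α).d := by
  have hdel := del_mem_typeForms hα.1 hpq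
  have hdelbar := delbar_mem_typeForms hα.1 hpq
  have hdelbar_delbar : F.delbar p (q + 1) (F.delbar p q α) = 0 := by
    have h := congrArg (F.component (k + 2) p (q + 2)) (d_del_add_d_delbar hα hpq)
    rwa [map_add, map_zero,
      component_d_eq_zero hdel (by omega) (by omega) (by omega) (by omega), zero_add] at h
  rw [d_eq_del_add_delbar hdelbar (by omega), hdelbar_delbar, add_zero]

theorem d_delbar_mem_typeForms (hα : α ∈ F.typeForms k p q) (hpq : p + q = k) :
    (F.delbar p q α).d ∈ F.typeForms (k + 2) (p + 1) (q + 1) :=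
  del_delbar_eq_d_delbar hα hpq ▸
    del_mem_typeForms (delbar_mem_typeForms hα.1 hpq).1 (by omega)

theorem d_del_mem_typeForms (hα : α ∈ F.typeForms k p q) (hpq : p + q = k) :
    (F.del p q α).d ∈ F.typeForms (k + 2) (p + 1) (q + 1) :=
  eq_neg_of_add_eq_zero_left (d_del_add_d_delbar hα hpq) ▸
    neg_mem (d_delbar_mem_typeForms hα hpq)

theorem component_d_eq_sum (hα : α ∈ F.basicForms ℂ k) (p q : ℕ) :
    F.component (k + 1) p q α.d =
      ∑ x ∈ antidiagonal k, F.component (k + 1) p q (F.component k x.1 x.2 α).d := by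
  conv_lhs => rw [← F.sum_component α]
  rw [DiffForm.d_sum fun x _ ↦ (component_mem_basicForms hα x.1 x.2).1, map_sum]

theorem delbar_component_zero (hα : α ∈ F.basicForms ℂ k) :
    F.delbar 0 k (F.component k 0 k α) = F.component (k + 1) 0 (k + 1) α.d := by
  rw [component_d_eq_sum hα, eq_comm]
  refine Finset.sum_eq_single_of_mem (0, k) (mem_antidiagonal.2 (zero_add k)) fun x hx hne ↦ ?_
  have hx' := mem_antidiagonal.1 hx
  exact component_d_eq_zero (component_mem_typeForms hα hx') hx' (by omega)
    (fun h ↦ hne (Prod.ext h.symm (by omega))) (by omega)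

theorem del_component_add_delbar_component (hα : α ∈ F.basicForms ℂ k) (hpq : p + 1 + q = k) :
    F.del p (q + 1) (F.component k p (q + 1) α) + F.delbar (p + 1) q (F.component k (p + 1) q α) =
      F.component (k + 1) (p + 1) (q + 1) α.d := by
  rw [component_d_eq_sum hα, eq_comm]
  refine Finset.sum_eq_add_of_mem (p, q + 1) (p + 1, q) (mem_antidiagonal.2 (by omega))
    (mem_antidiagonal.2 (by omega)) (by simp) fun x hx hne ↦ ?_
  have hx' := mem_antidiagonal.1 hx
  exact component_d_eq_zero (component_mem_typeForms hα hx') hx' (by omega)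
    (fun h ↦ hne.2 (Prod.ext h.symm (by omega))) (fun h ↦ hne.1 (Prod.ext (by omega) (by omega)))

theorem mem_delGraph_iff (hpq : p + q = k) {β : DiffForm m M ℂ (k + 1)} :
    (α, β) ∈ F.delGraph k p q ↔ α ∈ F.typeForms k p q ∧ F.del p q α = β := by
  refine ⟨fun ⟨hα, hβ, hsub⟩ ↦ ⟨hα, ?_⟩, ?_⟩
  · have h := component_of_mem_typeForms hsub (by omega) (show p + 1 + q = k + 1 by omega)
    rwa [map_sub, component_of_mem_typeForms hβ (by omega) (by omega), if_pos rfl,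
      if_neg (by omega), sub_eq_zero] at h
  · rintro ⟨hα, rfl⟩
    refine ⟨hα, del_mem_typeForms hα.1 hpq, ?_⟩
    rw [d_eq_del_add_delbar hα hpq, add_sub_cancel_left]
    exact delbar_mem_typeForms hα.1 hpq

theorem mem_delbarGraph_iff (hpq : p + q = k) {β : DiffForm m M ℂ (k + 1)} :
    (α, β) ∈ F.delbarGraph k p q ↔ α ∈ F.typeForms k p q ∧ F.delbar p q α = β := by
  refine ⟨fun ⟨hα, hβ, hsub⟩ ↦ ⟨hα, ?_⟩, ?_⟩
  · have h := component_of_mem_typeForms hsub (by omega) (show p + (q + 1) = k + 1 by omega)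
    rwa [map_sub, component_of_mem_typeForms hβ (by omega) (by omega), if_pos rfl,
      if_neg (by omega), sub_eq_zero] at h
  · rintro ⟨hα, rfl⟩
    refine ⟨hα, delbar_mem_typeForms hα.1 hpq, ?_⟩
    rw [d_eq_del_add_delbar hα hpq, add_sub_cancel_right]
    exact del_mem_typeForms hα.1 hpq

theorem mem_bottChernCocycles_iff (hpq : p + q = k) :
    α ∈ F.bottChernCocycles k p q ↔
      α ∈ F.typeForms k p q ∧ F.del p q α = 0 ∧ F.delbar p q α = 0 :=
  (and_congr (mem_delGraph_iff hpq) (mem_delbarGraph_iff hpq)).trans and_and_left.symm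

theorem mem_aeppliCocycles_iff (hpq : p + q = k) :
    α ∈ F.aeppliCocycles k p q ↔ α ∈ F.typeForms k p q ∧ (F.delbar p q α).d = 0 := by
  constructor
  · rintro ⟨ζ, hζ, hζ'⟩
    obtain ⟨hα, rfl⟩ := (mem_delbarGraph_iff hpq).1 hζ
    exact ⟨hα, del_delbar_eq_d_delbar hα hpq ▸ ((mem_delGraph_iff (by omega)).1 hζ').2⟩
  · rintro ⟨hα, h⟩
    exact ⟨_, (mem_delbarGraph_iff hpq).2 ⟨hα, rfl⟩, (mem_delGraph_iff (by omega)).2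
      ⟨delbar_mem_typeForms hα.1 hpq, (del_delbar_eq_d_delbar hα hpq).trans h⟩⟩

theorem mem_imDel_iff (hpq : p + q = k) {η : DiffForm m M ℂ (k + 1)} :
    η ∈ F.imDel (k + 1) (p + 1) q ↔ ∃ α ∈ F.typeForms k p q, F.del p q α = η := by
  simp only [imDel, graphIm, Submodule.mem_map, Prod.exists, LinearMap.snd_apply, exists_eq_right,
    mem_delGraph_iff hpq]

theorem mem_imDelbar_iff (hpq : p + q = k) {η : DiffForm m M ℂ (k + 1)} :
    η ∈ F.imDelbar (k + 1) p (q + 1) ↔ ∃ α ∈ F.typeForms k p q, F.delbar p q α = η := by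
  simp only [imDelbar, graphIm, Submodule.mem_map, Prod.exists, LinearMap.snd_apply,
    exists_eq_right, mem_delbarGraph_iff hpq]

theorem imDelDelbar_le_exactForms (F : TransverselyHolomorphicFoliation m n M T₀ ι)
    (hpq : p + q = k) : F.imDelDelbar k p q ≤ F.exactForms ℂ k := by
  match k, p, q, hpq with
  | 0, _, _, _ | 1, _, _, _ | _ + 2, 0, _, _ | _ + 2, _ + 1, 0, _ => exact bot_le
  | k + 2, p + 1, q + 1, hpq =>
    rintro _ ⟨⟨α, η⟩, ⟨ζ, hζ : (α, ζ) ∈ _, hη : (ζ, η) ∈ _⟩, rfl⟩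
    obtain ⟨hα, rfl⟩ := (mem_delbarGraph_iff (by omega)).1 hζ
    obtain ⟨hζ', rfl⟩ := (mem_delGraph_iff (by omega)).1 hη
    exact ⟨F.delbar p q α, hζ'.1, (del_delbar_eq_d_delbar hα (by omega)).symm⟩

/-! ### Finiteness of the basic cohomology -/

theorem component_mem_aeppliCocycles (hα : α ∈ F.closedForms ℂ k) (hpq : p + q = k) :
    F.component k p q α ∈ F.aeppliCocycles k p q := by
  obtain ⟨hα, hd⟩ := hα
  have hβ := component_mem_typeForms hα hpq
  refine (mem_aeppliCocycles_iff hpq).2 ⟨hβ, ?_⟩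
  cases p with
  | zero =>
    obtain rfl : q = k := by omega
    rw [delbar_component_zero hα, hd, map_zero, DiffForm.d_zero]
  | succ p =>
    have hγ := component_mem_typeForms hα (show p + (q + 1) = k by omega)
    have hdel := del_mem_typeForms hγ.1 (show p + (q + 1) = k by omega)
    have hdelbar := delbar_mem_typeForms hβ.1 hpq
    have hadd : (F.del p (q + 1) (F.component k p (q + 1) α)).d +
        (F.delbar (p + 1) q (F.component k (p + 1) q α)).d = 0 := by
      rw [← DiffForm.d_add hdel.1.1 hdelbar.1.1, del_component_add_delbar_component hα hpq, hd,
        map_zero, DiffForm.d_zero]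
    have h := congrArg (F.component (k + 2) (p + 2) (q + 1)) hadd
    rwa [map_add, map_zero,
      component_of_mem_typeForms (d_del_mem_typeForms hγ (by omega)) (by omega) (by omega),
      component_of_mem_typeForms (d_delbar_mem_typeForms hβ hpq) (by omega) (by omega),
      if_neg (by omega), if_pos rfl, zero_add] at h

theorem closedForms_le_iSup_aeppliCocycles (F : TransverselyHolomorphicFoliation m n M T₀ ι)
    (k : ℕ) :
    F.closedForms ℂ k ≤ ⨆ x : antidiagonal k, F.aeppliCocycles k x.1.1 x.1.2 := by
  intro α hα
  rw [← F.sum_component α]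
  exact sum_mem fun x hx ↦ Submodule.mem_iSup_of_mem ⟨x, hx⟩
    (component_mem_aeppliCocycles hα (mem_antidiagonal.1 hx))

theorem imDel_sup_imDelbar_le (F : TransverselyHolomorphicFoliation m n M T₀ ι) (hpq : p + q = k) :
    F.imDel k p q ⊔ F.imDelbar k p q ≤
      F.exactForms ℂ k ⊔ ⨆ x : antidiagonal k, F.imDelbar k x.1.1 x.1.2 := by
  have hdelbar {p q : ℕ} (hpq : p + q = k) :
      F.imDelbar k p q ≤ ⨆ x : antidiagonal k, F.imDelbar k x.1.1 x.1.2 :=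
    le_iSup_of_le ⟨(p, q), mem_antidiagonal.2 hpq⟩ le_rfl
  refine sup_le ?_ (le_sup_of_le_right (hdelbar hpq))
  match k, p, q, hpq with
  | 0, _, _, _ | _ + 1, 0, _, _ => exact bot_le
  | k + 1, p + 1, q, hpq =>
    intro η hη
    obtain ⟨α, hα, rfl⟩ := (mem_imDel_iff (by omega)).1 hη
    rw [eq_sub_of_add_eq (d_eq_del_add_delbar hα (by omega)).symm]
    exact Submodule.sub_mem_sup ⟨α, hα.1, rfl⟩ (hdelbar (show p + (q + 1) = k + 1 by omega)
      ((mem_imDelbar_iff (by omega)).2 ⟨α, hα, rfl⟩))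

theorem imDelbar_le_typeForms (F : TransverselyHolomorphicFoliation m n M T₀ ι)
    (hpq : p + q = k) : F.imDelbar k p q ≤ F.typeForms k p q := by
  match k, p, q, hpq with
  | 0, _, _, _ | _ + 1, _, 0, _ => exact bot_le
  | k + 1, p, q + 1, hpq =>
    intro η hη
    obtain ⟨α, hα, rfl⟩ := (mem_imDelbar_iff (by omega)).1 hη
    exact delbar_mem_typeForms hα.1 (by omega)

theorem delbar_eq_zero_of_mem_imDelbar (hpq : p + q = k) (hα : α ∈ F.imDelbar k p q) :
    F.delbar p q α = 0 := by
  match k, p, q, hpq with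
  | 0, _, _, _ | _ + 1, _, 0, _ =>
    obtain rfl : α = 0 := hα
    rw [delbar, DiffForm.d_zero, map_zero]
  | k + 1, p, q + 1, hpq =>
    obtain ⟨β, hβ, rfl⟩ := (mem_imDelbar_iff (by omega)).1 hα
    rw [delbar, component_of_mem_typeForms (d_delbar_mem_typeForms hβ (by omega)) (by omega)
      (by omega), if_neg (by omega)]

theorem closedForms_inf_iSup_imDelbar_le (F : TransverselyHolomorphicFoliation m n M T₀ ι)
    (k : ℕ) :
    F.closedForms ℂ k ⊓ ⨆ x : antidiagonal k, F.imDelbar k x.1.1 x.1.2 ≤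
      ⨆ x : antidiagonal k, F.bottChernCocycles k x.1.1 x.1.2 := by
  rintro α ⟨⟨hα, hd⟩, hα'⟩
  have hdelbar {p q : ℕ} (hpq : p + q = k) : F.delbar p q (F.component k p q α) = 0 :=
    delbar_eq_zero_of_mem_imDelbar hpq (component_mem_of_mem_iSup
      (fun _ _ ↦ F.imDelbar_le_typeForms) hα' hpq)
  have hdel {p q : ℕ} (hpq : p + q = k) : F.del p q (F.component k p q α) = 0 := by
    calc
      _ = F.component (k + 1) (p + 1) q α.d := by
        rw [component_d_eq_sum hα, eq_comm]
        refine Finset.sum_eq_single_of_mem (p, q) (mem_antidiagonal.2 hpq) fun x hx hne ↦ ?_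
        have hx' := mem_antidiagonal.1 hx
        by_cases hxp : x.1 = p + 1
        · rw [← hxp, show q = x.2 + 1 by omega]
          exact hdelbar hx'
        · exact component_d_eq_zero (component_mem_typeForms hα hx') hx' (by omega) (Ne.symm hxp)
            fun h ↦ hne (Prod.ext (by omega) (by omega))
      _ = 0 := by rw [hd, map_zero]
  rw [← F.sum_component α]
  refine sum_mem fun x hx ↦ Submodule.mem_iSup_of_mem ⟨x, hx⟩ ?_
  have hx' := mem_antidiagonal.1 hx
  exact (mem_bottChernCocycles_iff hx').2
    ⟨component_mem_typeForms hα hx', hdel hx', hdelbar hx'⟩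

theorem closedForms_inf_iSup_le (F : TransverselyHolomorphicFoliation m n M T₀ ι) (k : ℕ) :
    F.closedForms ℂ k ⊓
        ⨆ x : antidiagonal k, (F.imDel k x.1.1 x.1.2 ⊔ F.imDelbar k x.1.1 x.1.2) ≤
      F.exactForms ℂ k ⊔ ⨆ x : antidiagonal k, F.bottChernCocycles k x.1.1 x.1.2 :=
  calc
    _ ≤ F.closedForms ℂ k ⊓
          (F.exactForms ℂ k ⊔ ⨆ x : antidiagonal k, F.imDelbar k x.1.1 x.1.2) :=
      inf_le_inf_left _ (iSup_le fun x ↦ F.imDel_sup_imDelbar_le (mem_antidiagonal.1 x.2))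
    _ = F.exactForms ℂ k ⊔
          F.closedForms ℂ k ⊓ ⨆ x : antidiagonal k, F.imDelbar k x.1.1 x.1.2 := by
      rw [inf_comm, sup_inf_assoc_of_le _ (F.exactForms_le_closedForms ℂ k), inf_comm]
    _ ≤ _ := sup_le_sup_left (F.closedForms_inf_iSup_imDelbar_le k) _

theorem finiteDimensional_basicCohomology_complex (F : TransverselyHolomorphicFoliation m n M T₀ ι)
    (hBC : ∀ p q, p + q = k → FiniteDimensional ℂ (F.BottChernCohomology p q))
    (hA : ∀ p q, p + q = k → FiniteDimensional ℂ (F.AeppliCohomology p q)) :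
    FiniteDimensional ℂ (F.BasicCohomology ℂ k) := by
  refine finiteDimensional_quotient_of_le_iSup (ι := antidiagonal k) ?_ ?_
    (F.closedForms_le_iSup_aeppliCocycles k) (F.closedForms_inf_iSup_le k)
    fun x ↦ F.imDelDelbar_le_exactForms (mem_antidiagonal.1 x.2)
  · rintro ⟨⟨p, q⟩, hpq⟩
    obtain rfl := mem_antidiagonal.1 hpq
    exact hA p q rfl
  · rintro ⟨⟨p, q⟩, hpq⟩
    obtain rfl := mem_antidiagonal.1 hpq
    exact hBC p q rfl

end TransverselyHolomorphicFoliation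

/-! ### Change of coefficients -/

namespace DiffForm

variable {m : ℕ} {M : Type*} [TopologicalSpace M] [ChartedSpace (EuclideanSpace ℝ (Fin m)) M]
  {𝕜 𝕜' : Type*} [RCLike 𝕜] [RCLike 𝕜'] {k : ℕ} {α : DiffForm m M 𝕜 k}

instance : Module ℝ (DiffForm m M 𝕜 k) :=
  inferInstanceAs (Module ℝ ((x : M) → TangentSpace (𝓡 m) x [⋀^Fin k]→L[ℝ] 𝕜))

instance : IsScalarTower ℝ 𝕜 (DiffForm m M 𝕜 k) :=
  inferInstanceAs (IsScalarTower ℝ 𝕜 ((x : M) → TangentSpace (𝓡 m) x [⋀^Fin k]→L[ℝ] 𝕜))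

/-- The change of coefficients of differential forms along a real linear map `L : 𝕜 → 𝕜'`. -/
def mapCoeff (L : 𝕜 →L[ℝ] 𝕜') : DiffForm m M 𝕜 k →ₗ[ℝ] DiffForm m M 𝕜' k where
  toFun α x := L.compContinuousAlternatingMap (α x)
  map_add' α β := by
    funext x
    ext v
    exact map_add L (α x v) (β x v)
  map_smul' c α := by
    funext x
    ext v
    exact map_smul L c (α x v)

theorem mapCoeff_apply (L : 𝕜 →L[ℝ] 𝕜') (α : DiffForm m M 𝕜 k) (x : M)
    (v : Fin k → TangentSpace (𝓡 m) x) : mapCoeff L α x v = L (α x v) := rfl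

theorem inChart_mapCoeff (L : 𝕜 →L[ℝ] 𝕜') (α : DiffForm m M 𝕜 k) (x : M) :
    (mapCoeff L α).inChart x = (ContinuousLinearMap.compContinuousAlternatingMapCLM ℝ
      (EuclideanSpace ℝ (Fin m)) 𝕜 𝕜' (Fin k) L) ∘ α.inChart x := rfl

theorem IsSmooth.mapCoeff (hα : α.IsSmooth) (L : 𝕜 →L[ℝ] 𝕜') :
    (mapCoeff L α).IsSmooth := fun x ↦ by
  rw [inChart_mapCoeff]
  exact (ContinuousLinearMap.contDiff _).comp_contDiffOn (hα x)

theorem IsSmooth.d_mapCoeff (hα : α.IsSmooth) (L : 𝕜 →L[ℝ] 𝕜') :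
    (DiffForm.mapCoeff L α).d = DiffForm.mapCoeff L α.d := by
  have hext (x : M) : extDeriv ((DiffForm.mapCoeff L α).inChart x) (extChartAt (𝓡 m) x x) =
      L.compContinuousAlternatingMap (extDeriv (α.inChart x) (extChartAt (𝓡 m) x x)) := by
    ext v
    rw [inChart_mapCoeff, extDeriv, ((ContinuousLinearMap.hasFDerivAt _).comp _
      (hα.differentiableAt x).hasFDerivAt).fderiv]
    simp only [extDeriv, ContinuousAlternatingMap.alternatizeUncurryFin_apply,
      ContinuousLinearMap.compContinuousAlternatingMap_coe, Function.comp_apply, map_sum,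
      map_zsmul]
    rfl
  funext x
  simp only [DiffForm.d, hext]
  rfl

theorem mapCoeff_map_mapCoeff_map (α : DiffForm m M 𝕜 k) :
    mapCoeff (RCLike.map ℂ 𝕜) (mapCoeff (RCLike.map 𝕜 ℂ) α) = α := by
  funext x
  ext v
  rw [mapCoeff_apply, mapCoeff_apply]
  generalize α x v = a
  simp [RCLike.map_apply]

end DiffForm

namespace TransverselyHolomorphicFoliation

variable {m n : ℕ} {M T₀ ι : Type*}
  [TopologicalSpace M] [ChartedSpace (EuclideanSpace ℝ (Fin m)) M]
  [TopologicalSpace T₀] [ChartedSpace (EuclideanSpace ℂ (Fin n)) T₀]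
  {F : TransverselyHolomorphicFoliation m n M T₀ ι}
  {𝕜 𝕜' : Type*} [RCLike 𝕜] [RCLike 𝕜'] {k : ℕ} {α : DiffForm m M 𝕜 k}

theorem IsHorizontal.mapCoeff (hα : F.IsHorizontal α) (L : 𝕜 →L[ℝ] 𝕜') :
    F.IsHorizontal (α.mapCoeff L) := fun x v j hv ↦ by
  rw [DiffForm.mapCoeff_apply, hα x v j hv, map_zero]

theorem mapCoeff_mem_basicForms (hα : α ∈ F.basicForms 𝕜 k) (L : 𝕜 →L[ℝ] 𝕜') :
    α.mapCoeff L ∈ F.basicForms 𝕜' k :=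
  ⟨hα.1.mapCoeff L, hα.2.1.mapCoeff L, by rw [hα.1.d_mapCoeff]; exact hα.2.2.mapCoeff L⟩

theorem mapCoeff_mem_closedForms (hα : α ∈ F.closedForms 𝕜 k) (L : 𝕜 →L[ℝ] 𝕜') :
    α.mapCoeff L ∈ F.closedForms 𝕜' k :=
  ⟨mapCoeff_mem_basicForms hα.1 L, by rw [hα.1.1.d_mapCoeff, hα.2, map_zero]⟩

theorem mapCoeff_mem_exactForms (hα : α ∈ F.exactForms 𝕜 k) (L : 𝕜 →L[ℝ] 𝕜') :
    α.mapCoeff L ∈ F.exactForms 𝕜' k := by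
  cases k with
  | zero =>
    obtain rfl : α = 0 := hα
    rw [map_zero]
    exact zero_mem _
  | succ k =>
    obtain ⟨β, hβ, rfl⟩ := hα
    exact ⟨β.mapCoeff L, mapCoeff_mem_basicForms hβ L, hβ.1.d_mapCoeff L⟩

theorem finiteDimensional_basicCohomology_of_complex
    (h : FiniteDimensional ℂ (F.BasicCohomology ℂ k)) (𝕜 : Type*) [RCLike 𝕜] :
    FiniteDimensional 𝕜 (F.BasicCohomology 𝕜 k) :=
  finite_quotient_submoduleOf_of_mapsTo (DiffForm.mapCoeff (RCLike.map ℂ 𝕜))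
    (fun α hα ↦ ⟨α.mapCoeff (RCLike.map 𝕜 ℂ), mapCoeff_mem_closedForms hα _,
      DiffForm.mapCoeff_map_mapCoeff_map α⟩)
    (fun _ hα ↦ mapCoeff_mem_exactForms hα _) h

end TransverselyHolomorphicFoliation

end

theorem corollary1 {m n : ℕ} {M T₀ ι : Type*}
    [TopologicalSpace M] [ChartedSpace (EuclideanSpace ℝ (Fin m)) M] [IsManifold (𝓡 m) ∞ M]
    [TopologicalSpace T₀] [ChartedSpace (EuclideanSpace ℂ (Fin n)) T₀]
    [IsManifold 𝓘(ℂ, EuclideanSpace ℂ (Fin n)) ω T₀]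
    (F : TransverselyHolomorphicFoliation m n M T₀ ι)
    {𝕜 : Type*} [RCLike 𝕜] (k : ℕ)
    (h : ¬ FiniteDimensional 𝕜 (F.BasicCohomology 𝕜 k)) :
    ∃ p q : ℕ, p + q = k ∧
      (¬ FiniteDimensional ℂ (F.BottChernCohomology p q) ∨
        ¬ FiniteDimensional ℂ (F.AeppliCohomology p q)) := by
  by_contra! hfin
  exact h (TransverselyHolomorphicFoliation.finiteDimensional_basicCohomology_of_complex
    (F.finiteDimensional_basicCohomology_complex (fun p q hpq ↦ (hfin p q hpq).1)
      fun p q hpq ↦ (hfin p q hpq).2) 𝕜)
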